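/- Let $d\ge 1$, $0<s<1$, $1\le p<\infty$, and let $A\in C(\mathbb{R}^d,\mathbb{R}^d)$ be such that its exterior derivative $dA$ (in the sense of distributions, $A$ being seen as a $1$-form) belongs to $L^\infty(\mathbb{R}^d,\bigwedge^2\mathbb{R}^d)$. Define * $W^{1,p}_A(\mathbb{R}^d)=\{u\in W^{1,1}_{\mathrm{loc}}(\mathbb{R}^d,\mathbb{C}) : \|u\|_{W^{1,p}_A}^p=\int_{\mathbb{R}^d}|u|^p+|\nabla u+iAu|^p<\infty\}$; * $W^{s,p}_A(\mathbb{R}^d)=\{u:\mathbb{R}^d\to\mathbb{C}\text{ measurable} : \|u\|_{W^{s,p}_A}^p=\|u\|_{L^p}^p+|u|_{W^{s,p}_A}^p<\infty\}$, functions being identified when equal almost everywhere, where $$|u|_{W^{s,p}_A}^p=\int_{\mathbb{R}^d}\int_{\mathbb{R}^d}\frac{|e^{i I_A(x,y)}u(y)-u(x)|^p}{|y-x|^{d+sp}}\,dx\,dy,\qquad I_A(x,y)=\int_0^1 A((1-t)x+ty)\cdot(y-x)\,dt;$$ * for two normed spaces $X_0,X_1$ contained in a common vector space, $0<\theta<1$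 and $1\le q<\infty$, the real interpolation space $(X_0,X_1)_{\theta,q}$ as the set of $a\in X_0+X_1$ such that $$\|a\|_{(X_0,X_1)_{\theta,q}}=\Bigl(\int_0^\infty\bigl(t^{-\theta}K(t,a)\bigr)^q\,\frac{dt}{t}\Bigr)^{1/q}<\infty,\qquad K(t,a)=\inf\{\|a_0\|_{X_0}+t\|a_1\|_{X_1} : a=a_0+a_1,\ a_0\in X_0,\ a_1\in X_1\}.$$ Then $$W^{s,p}_A(\mathbb{R}^d)=\bigl(L^p(\mathbb{R}^d),W^{1,p}_A(\mathbb{R}^d)\bigr)_{s,p}$$ (equivalently, $\bigl(W^{1,p}_A(\mathbb{R}^d),L^p(\mathbb{R}^d)\bigr)_{1-s,p}$), as sets and with equivalent norms: there is a finite constant $C$ such that every $u$ in this space satisfies $$\|u\|_{(L^p,W^{1,p}_A)_{s,p}}\le C\|u\|_{W^{s,p}_A}\quad\text{and}\quad \|u\|_{W^{s,p}_A}\le C\|u\|_{(L^p,W^{1,p}_A)_{s,p}}.$$ -/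

import Mathlib

open MeasureTheory
open scoped ENNReal ContDiff InnerProductSpace

noncomputable section

namespace MagneticSobolev

/-- The Euclidean space of dimension `d`, with its Euclidean norm and Lebesgue measure. -/
abbrev Rd (d : ℕ) : Type := EuclideanSpace ℝ (Fin d)

/-- Complex measurable functions on the Euclidean space, modulo equality almost everywhere.
All the function spaces below are sets of such classes. -/
abbrev L0 (d : ℕ) : Type := Rd d →ₘ[volume] ℂ

/-- A real test function: smooth with compact support. -/
def IsTestFunction {d : ℕ} (φ : Rd d → ℝ) : Prop :=
  ContDiff ℝ ∞ φ ∧ HasCompactSupport φ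

/-- The `2`-form `B` is the exterior derivative, in the sense of distributions, of the vector field
`A` seen as a `1`-form: `dA [v, w] = ∂_v (A · w) - ∂_w (A · v)`. -/
def IsWeakExtDeriv {d : ℕ} (A : Rd d → Rd d) (B : Rd d → Rd d [⋀^Fin 2]→L[ℝ] ℝ) : Prop :=
  ∀ φ : Rd d → ℝ, IsTestFunction φ → ∀ v w : Rd d,
    ∫ x, (⟪A x, w⟫_ℝ * fderiv ℝ φ x v - ⟪A x, v⟫_ℝ * fderiv ℝ φ x w) =
      - ∫ x, B x ![v, w] * φ x

/-- The distributional exterior derivative of `A` is (represented by) an essentially bounded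
measurable `2`-form. -/
def HasBoundedExtDeriv {d : ℕ} (A : Rd d → Rd d) : Prop :=
  ∃ B : Rd d → Rd d [⋀^Fin 2]→L[ℝ] ℝ, MemLp B ⊤ volume ∧ IsWeakExtDeriv A B

/-- `u` belongs to `W^{1,1}_loc`, with weak gradient `G`. -/
def HasWeakGradient {d : ℕ} (u : Rd d → ℂ) (G : Rd d → EuclideanSpace ℂ (Fin d)) : Prop :=
  LocallyIntegrable u volume ∧ LocallyIntegrable G volume ∧
    ∀ φ : Rd d → ℝ, IsTestFunction φ → ∀ j : Fin d,
      ∫ x, fderiv ℝ φ x (EuclideanSpace.single j 1) • u x = - ∫ x, φ x • G x j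

/-- The covariant gradient `∇u + i A u`, where `G = ∇u`. -/
def covariantGradient {d : ℕ} (A : Rd d → Rd d) (u : Rd d → ℂ)
    (G : Rd d → EuclideanSpace ℂ (Fin d)) (x : Rd d) : EuclideanSpace ℂ (Fin d) :=
  WithLp.toLp 2 fun j => G x j + Complex.I * (A x j : ℂ) * u x

/-- The (extended) norm `‖u‖_{L^p}`. -/
def lpNorm {d : ℕ} (p : ℝ) (u : L0 d) : ℝ≥0∞ :=
  eLpNorm u (ENNReal.ofReal p) volume

/-- The (extended) norm of `W^{1,p}_A`, that is `(∫ |u|^p + |∇_A u|^p)^{1/p}`. A weak gradient is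
unique up to a null set, so the infimum is over at most one value; it is `∞` when `u` has no weak
gradient, that is, when `u` is not in `W^{1,1}_loc`. -/
def sobolevNorm {d : ℕ} (A : Rd d → Rd d) (p : ℝ) (u : L0 d) : ℝ≥0∞ :=
  ⨅ (G : Rd d → EuclideanSpace ℂ (Fin d)) (_ : HasWeakGradient u G),
    (∫⁻ x, (‖u x‖ₑ ^ p + ‖covariantGradient A u G x‖ₑ ^ p)) ^ (1 / p)

/-- The potential `I_A (x, y)`: the integral of `A` along the segment from `x` to `y`. -/
def linePotential {d : ℕ} (A : Rd d → Rd d) (x y : Rd d) : ℝ :=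
  ∫ t in (0 : ℝ)..1, ⟪A ((1 - t) • x + t • y), y - x⟫_ℝ

/-- The `p`-th power of the magnetic Gagliardo seminorm. -/
def gagliardoEnergy {d : ℕ} (A : Rd d → Rd d) (s p : ℝ) (u : L0 d) : ℝ≥0∞ :=
  ∫⁻ x, ∫⁻ y,
    ‖Complex.exp (Complex.I * (linePotential A x y : ℂ)) * u y - u x‖ₑ ^ p
      / ‖y - x‖ₑ ^ ((d : ℝ) + s * p)

/-- The (extended) norm of the magnetic fractional Sobolev space `W^{s,p}_A`. -/
def fractionalNorm {d : ℕ} (A : Rd d → Rd d) (s p : ℝ) (u : L0 d) : ℝ≥0∞ :=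
  (lpNorm p u ^ p + gagliardoEnergy A s p u) ^ (1 / p)

/-- The magnetic fractional Sobolev space `W^{s,p}_A`. -/
def fractionalSpace {d : ℕ} (A : Rd d → Rd d) (s p : ℝ) : Set (L0 d) :=
  {u | fractionalNorm A s p u < ⊤}

section Interpolation

/-- Peetre's functional `K (t, a; X₀, X₁)`, for two normed spaces `X₀` and `X₁` inside a common
ambient space `V`, given by their norms `N₀` and `N₁` extended by `∞` to `V`. -/
def peetreK {V : Type*} [AddCommGroup V] (N₀ N₁ : V → ℝ≥0∞) (t : ℝ) (a : V) : ℝ≥0∞ :=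
  ⨅ (a₀ : V) (a₁ : V) (_ : a₀ + a₁ = a), (N₀ a₀ + ENNReal.ofReal t * N₁ a₁)

/-- The norm of the real interpolation space `(X₀, X₁)_{θ,q}`, that is
`(∫_0^∞ (t^{-θ} K (t, a; X₀, X₁))^q dt / t)^{1/q}`; it is `∞` outside of `X₀ + X₁`. -/
def interpolationNorm {V : Type*} [AddCommGroup V] (N₀ N₁ : V → ℝ≥0∞) (θ q : ℝ) (a : V) : ℝ≥0∞ :=
  (∫⁻ t in Set.Ioi (0 : ℝ),
    (ENNReal.ofReal (t ^ (-θ)) * peetreK N₀ N₁ t a) ^ q * ENNReal.ofReal (1 / t)) ^ (1 / q)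

/-- The real interpolation space `(X₀, X₁)_{θ,q}`. -/
def interpolationSpace {V : Type*} [AddCommGroup V] (N₀ N₁ : V → ℝ≥0∞) (θ q : ℝ) : Set V :=
  {a | interpolationNorm N₀ N₁ θ q a < ⊤}

end Interpolation

end MagneticSobolev

end

/-!
Write `T_h u (x) = e^{i I_A (x, x + h)} u (x + h)` for the magnetic translations. They are isometries
of `L^p`, and the Gagliardo energy is the integral of `‖T_h u - u‖_p ^ p / |h| ^ (d + s p)` over `h`
(`gagliardoEnergy_eq`). The theorem compares the modulus of continuity `‖T_h u - u‖_p` with Peetre's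
functional `K (|h|, u)`.

Fractional norm by interpolation norm. If `u = a₀ + a₁`, then `‖T_h a₀ - a₀‖_p ≤ 2 ‖a₀‖_p`, and
`‖T_h a₁ - a₁‖_p ≤ 2 |h| ‖a₁‖_{W^{1,p}_A}`, since along the segment from `x` to `x + h` the derivative
of `T_{τ h} a₁ (x)` in `τ` is, up to a phase, the covariant derivative of `a₁`. For a
function with a mere weak gradient this is obtained by mollification: the commutator of the
covariant derivative with the mollification is of order zero, with the oscillation of `A`
at the scale of the mollification as coefficient
(`HasWeakGradient.lintegral_magneticTranslation_sub_le`). Hence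
`‖T_h u - u‖_p ≤ 2 K (|h|, u)`, and polar coordinates conclude (`exists_fractionalNorm_le`).
This direction does not involve `dA`.

Interpolation norm by fractional norm. For `t ≤ 1`, `u` is decomposed into its magnetic mollification
`u_t (x) = ∫ ρ_t (y - x) e^{i I_A (x, y)} u (y) dy` and the remainder. The remainder is an average
of `T_h u - u` over `|h| < 2 t`. For the covariant gradient of `u_t`, one compares
`e^{i I_A (x, z)} u_t (z)` with `u_t (x)`: the phases `I_A (x, z) + I_A (z, y)` and
`I_A (x, y)` differ by the flux of `dA` through the triangle `x, z, y`, which is at most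
`‖dA‖_∞ |z - x| (|y - x| + |z - x|)`. This flux bound (`abs_flux_le`) is the only place where `dA` is
used; it is Stokes' theorem for the mollifications of `A`. It also shows that `u_t` is locally
Lipschitz, hence has a weak gradient given by its derivatives along the axes, with
`t |∇_A u_t|` bounded by averages of `|T_h u - u|` and of `t ^ 2 |u|`
(`enorm_gaugeFactor_mul_magneticMollification_sub_le`, `ae_enorm_covariantGradient_le`).
This bounds `K (t, u) ^ p` by the average of `‖T_h u - u‖_p ^ p` over `|h| < 2 t`, plus
`t ^ p ‖u‖_p ^ p` (`exists_peetreK_rpow_le`); for `t > 1`, `K (t, u) ≤ ‖u‖_p`. Integrating in `t`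
gives back the Gagliardo kernel (`exists_interpolationNorm_le`).
-/

noncomputable section

namespace MagneticSobolev

open Filter Topology

/-! ### The line potential -/

theorem continuous_linePotential {d : ℕ} {A : Rd d → Rd d} (hA : Continuous A) {X : Type*}
    [TopologicalSpace X] {f g : X → Rd d} (hf : Continuous f) (hg : Continuous g) :
    Continuous fun q => linePotential A (f q) (g q) := by
  unfold linePotential
  apply intervalIntegral.continuous_parametric_intervalIntegral_of_continuous'
  simp only [Function.uncurry_def]
  fun_prop

theorem linePotential_self {d : ℕ} (A : Rd d → Rd d) (x : Rd d) : linePotential A x x = 0 := by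
  simp [linePotential]

theorem linePotential_add_smul {d : ℕ} (A : Rd d → Rd d) (x v : Rd d) (τ : ℝ) :
    linePotential A x (x + τ • v) = ∫ σ in (0 : ℝ)..τ, ⟪A (x + σ • v), v⟫_ℝ := by
  have h := intervalIntegral.smul_integral_comp_mul_left
    (fun σ : ℝ => ⟪A (x + σ • v), v⟫_ℝ) (a := 0) (b := 1) τ
  rw [mul_zero, mul_one] at h
  rw [← h, linePotential, smul_eq_mul, ← intervalIntegral.integral_const_mul]
  congr 1
  ext t
  rw [add_sub_cancel_left, inner_smul_right]
  congr 3
  module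

theorem hasDerivAt_linePotential {d : ℕ} {A : Rd d → Rd d} (hA : Continuous A) (x v : Rd d)
    (τ : ℝ) :
    HasDerivAt (fun τ : ℝ => linePotential A x (x + τ • v)) ⟪A (x + τ • v), v⟫_ℝ τ := by
  simp only [linePotential_add_smul]
  have hc : Continuous fun σ : ℝ => ⟪A (x + σ • v), v⟫_ℝ := by fun_prop
  exact intervalIntegral.integral_hasDerivAt_right (hc.intervalIntegrable _ _)
    (hc.stronglyMeasurableAtFilter _ _) hc.continuousAt

theorem abs_linePotential_le {d : ℕ} {A : Rd d → Rd d} {s : Set (Rd d)} (hs : Convex ℝ s) {K : ℝ}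
    (hK : ∀ x ∈ s, ‖A x‖ ≤ K) {x y : Rd d} (hx : x ∈ s) (hy : y ∈ s) :
    |linePotential A x y| ≤ K * ‖y - x‖ := by
  have h := intervalIntegral.norm_integral_le_of_norm_le_const
    (f := fun t : ℝ => ⟪A ((1 - t) • x + t • y), y - x⟫_ℝ) (a := 0) (b := 1) (C := K * ‖y - x‖)
    (fun t ht => by
      rw [Set.uIoc_of_le zero_le_one] at ht
      refine (norm_inner_le_norm _ _).trans ?_
      gcongr
      exact hK _ (hs hx hy (by linarith [ht.2]) ht.1.le (by ring)))
  simpa [linePotential] using h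

/-! ### The flux of the magnetic field through a triangle -/

theorem hasDerivAt_integral_unitInterval {F F' : ℝ → ℝ → ℝ}
    (hF : Continuous (Function.uncurry F)) (hF' : Continuous (Function.uncurry F'))
    (h : ∀ τ t, HasDerivAt (fun τ => F τ t) (F' τ t) τ) (τ : ℝ) :
    HasDerivAt (fun τ => ∫ t in (0 : ℝ)..1, F τ t) (∫ t in (0 : ℝ)..1, F' τ t) τ := by
  obtain ⟨K, hK⟩ := ((isCompact_closedBall τ 1).prod
    (isCompact_Icc (a := (0 : ℝ)) (b := 1))).exists_bound_of_continuousOn hF'.continuousOn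
  have hc : ∀ τ, Continuous (F τ) := fun τ => hF.comp (by fun_prop : Continuous fun t => (τ, t))
  have hc' : Continuous (F' τ) := hF'.comp (by fun_prop : Continuous fun t => (τ, t))
  refine (intervalIntegral.hasDerivAt_integral_of_dominated_loc_of_deriv_le (bound := fun _ => K)
    (Metric.closedBall_mem_nhds τ one_pos) (Eventually.of_forall fun τ =>
      (hc τ).aestronglyMeasurable) ((hc τ).intervalIntegrable _ _)
    hc'.aestronglyMeasurable (Eventually.of_forall fun t ht x hx => ?_)
    intervalIntegrable_const (Eventually.of_forall fun t _ x _ => h x t)).2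
  rw [Set.uIoc_of_le zero_le_one] at ht
  exact hK (x, t) ⟨hx, ht.1.le, ht.2⟩

/-- Infinitesimal form of Stokes' theorem on a triangle: if the vertex `z` moves along `v`, the
circulation of `A` along the broken line `x → z → y` varies by the integral of the
curl over the segment from `z` to `y`. -/
theorem hasDerivAt_linePotential_add {d : ℕ} {A : Rd d → Rd d} (hA : ContDiff ℝ 1 A)
    (x y v : Rd d) (τ : ℝ) :
    HasDerivAt (fun τ : ℝ => linePotential A x (x + τ • v) + linePotential A (x + τ • v) y)
      (∫ t in (0 : ℝ)..1, (1 - t) *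
        (⟪fderiv ℝ A ((1 - t) • (x + τ • v) + t • y) v, y - (x + τ • v)⟫_ℝ
          - ⟪fderiv ℝ A ((1 - t) • (x + τ • v) + t • y) (y - (x + τ • v)), v⟫_ℝ)) τ := by
  have hAc := hA.continuous
  have hDc : Continuous (fderiv ℝ A) := hA.continuous_fderiv one_ne_zero
  have hAd : ∀ q, HasFDerivAt A (fderiv ℝ A q) q := fun q =>
    (hA.differentiable one_ne_zero q).hasFDerivAt
  have h1 := hasDerivAt_linePotential hAc x v τ
  have h2 := hasDerivAt_integral_unitInterval
    (F := fun τ t => ⟪A ((1 - t) • (x + τ • v) + t • y), y - (x + τ • v)⟫_ℝ)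
    (F' := fun τ t => ⟪A ((1 - t) • (x + τ • v) + t • y), -v⟫_ℝ
      + ⟪fderiv ℝ A ((1 - t) • (x + τ • v) + t • y) ((1 - t) • v), y - (x + τ • v)⟫_ℝ)
    (by simp only [Function.uncurry_def]; fun_prop)
    (by simp only [Function.uncurry_def]; fun_prop)
    (fun τ t => by
      have hz : HasDerivAt (fun τ : ℝ => x + τ • v) v τ := by
        simpa using ((hasDerivAt_id τ).smul_const v).const_add x
      have hP : HasDerivAt (fun τ : ℝ => (1 - t) • (x + τ • v) + t • y) ((1 - t) • v) τ :=
        (hz.const_smul (1 - t)).add_const _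
      exact ((hAd _).comp_hasDerivAt τ hP).inner ℝ (hz.const_sub y)) τ
  set z := x + τ • v with hz
  -- integrating the derivative of `(1 - t) A · v` along the segment from `z` to `y`
  have h3 : ∫ t in (0 : ℝ)..1, ((1 - t) * ⟪fderiv ℝ A ((1 - t) • z + t • y) (y - z), v⟫_ℝ
      - ⟪A ((1 - t) • z + t • y), v⟫_ℝ) = - ⟪A z, v⟫_ℝ := by
    have := intervalIntegral.integral_eq_sub_of_hasDerivAt (a := 0) (b := 1)
      (f := fun t : ℝ => (1 - t) * ⟪A ((1 - t) • z + t • y), v⟫_ℝ)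
      (f' := fun t => (1 - t) * ⟪fderiv ℝ A ((1 - t) • z + t • y) (y - z), v⟫_ℝ
        - ⟪A ((1 - t) • z + t • y), v⟫_ℝ)
      (fun t _ => by
        have hP : HasDerivAt (fun t : ℝ => (1 - t) • z + t • y) (y - z) t := by
          have := (((hasDerivAt_id t).const_sub 1).smul_const z).add
            ((hasDerivAt_id t).smul_const y)
          refine this.congr_deriv ?_
          module
        have hI := ((hAd _).comp_hasDerivAt t hP).inner ℝ (hasDerivAt_const t v)
        have := ((hasDerivAt_id t).const_sub 1).mul hI
        refine this.congr_deriv ?_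
        simp
        ring)
      (Continuous.intervalIntegrable (by fun_prop) _ _)
    rw [this]
    simp
  refine (h1.add h2).congr_deriv ?_
  rw [← neg_neg ⟪A z, v⟫_ℝ, ← h3, ← intervalIntegral.integral_neg,
    ← intervalIntegral.integral_add]
  · congr 1
    ext t
    simp only [map_smul, inner_neg_right, inner_smul_left, RCLike.conj_to_real]
    ring
  · exact Continuous.intervalIntegrable (by fun_prop) _ _
  · exact Continuous.intervalIntegrable (by fun_prop) _ _

/-- The circulation along a triangle of a `C¹` field whose curl is bounded by `M`. The
segment from `z` to `y` has length at most `‖y - x‖ + ‖z - x‖`, whence the last factor. -/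
theorem abs_flux_le_of_contDiff {d : ℕ} {A : Rd d → Rd d} (hA : ContDiff ℝ 1 A) {M : ℝ}
    (hM : ∀ q v w, |⟪fderiv ℝ A q v, w⟫_ℝ - ⟪fderiv ℝ A q w, v⟫_ℝ| ≤ M * ‖v‖ * ‖w‖)
    (hM0 : 0 ≤ M) (x z y : Rd d) :
    |linePotential A x z + linePotential A z y - linePotential A x y|
      ≤ M * ‖z - x‖ * (‖y - x‖ + ‖z - x‖) := by
  set v := z - x with hv
  have h := norm_image_sub_le_of_norm_deriv_le_segment_01'
    (C := M * ‖v‖ * (‖y - x‖ + ‖v‖))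
    (fun τ _ => (hasDerivAt_linePotential_add hA x y v τ).hasDerivWithinAt) (fun τ hτ => by
      have hle := intervalIntegral.norm_integral_le_of_norm_le_const (a := 0) (b := 1)
        (C := M * ‖v‖ * (‖y - x‖ + ‖v‖)) (f := fun t : ℝ => (1 - t) *
        (⟪fderiv ℝ A ((1 - t) • (x + τ • v) + t • y) v, y - (x + τ • v)⟫_ℝ
          - ⟪fderiv ℝ A ((1 - t) • (x + τ • v) + t • y) (y - (x + τ • v)), v⟫_ℝ)) (fun t ht => by
          rw [Set.uIoc_of_le zero_le_one] at ht
          rw [norm_mul, Real.norm_eq_abs, Real.norm_eq_abs, abs_of_nonneg (by linarith [ht.2])]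
          refine (mul_le_of_le_one_left (abs_nonneg _) (by linarith [ht.1])).trans
            ((hM _ _ _).trans ?_)
          gcongr
          calc ‖y - (x + τ • v)‖ = ‖(y - x) - τ • v‖ := by congr 1; abel
            _ ≤ ‖y - x‖ + ‖τ • v‖ := norm_sub_le _ _
            _ ≤ ‖y - x‖ + ‖v‖ := by
              gcongr
              rw [norm_smul, Real.norm_eq_abs, abs_of_nonneg hτ.1]
              exact mul_le_of_le_one_left (norm_nonneg _) hτ.2.le)
      simpa using hle)
  have hz : x + v = z := by rw [hv]; abel
  simpa [hz, linePotential_self] using h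

theorem isTestFunction_normed_sub {d : ℕ} (φ : ContDiffBump (0 : Rd d)) (x : Rd d) :
    IsTestFunction fun y => φ.normed volume (x - y) :=
  ⟨(φ.contDiff_normed (n := ⊤)).comp (contDiff_const.sub contDiff_id),
    φ.hasCompactSupport_normed.comp_homeomorph (Homeomorph.subLeft x)⟩

theorem fderiv_sub_left_apply {d : ℕ} {f : Rd d → ℝ} (hf : Differentiable ℝ f) (x y v : Rd d) :
    fderiv ℝ (fun y => f (x - y)) y v = - fderiv ℝ f (x - y) v := by
  have h1 : HasFDerivAt (fun y : Rd d => x - y) (-ContinuousLinearMap.id ℝ (Rd d)) y := by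
    simpa using (hasFDerivAt_id y).const_sub x
  have := ((hf (x - y)).hasFDerivAt.comp y h1).fderiv
  simp only [Function.comp_def] at this
  rw [this]
  simp

open scoped Convolution in
theorem fderiv_convolution_apply {d : ℕ} {E : Type*} [NormedAddCommGroup E] [NormedSpace ℝ E]
    [CompleteSpace E]
    {f : Rd d → ℝ} (hfs : HasCompactSupport f) (hf : ContDiff ℝ 1 f) {g : Rd d → E}
    (hg : LocallyIntegrable g volume) (x v : Rd d) :
    Integrable (fun y => fderiv ℝ f (x - y) v • g y) volume ∧
    fderiv ℝ (f ⋆[ContinuousLinearMap.lsmul ℝ ℝ, volume] g) x v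
      = ∫ y, fderiv ℝ f (x - y) v • g y := by
  have hex := (hfs.fderiv ℝ).convolutionExists_left
    ((ContinuousLinearMap.lsmul ℝ ℝ : ℝ →L[ℝ] E →L[ℝ] E).precompL (Rd d))
    (hf.continuous_fderiv one_ne_zero) hg x
  have hex' := hex.integrable_swap
  constructor
  · exact hex'.apply_continuousLinearMap v
  · rw [(hfs.hasFDerivAt_convolution_left _ hf hg x).fderiv, convolution_eq_swap,
      ContinuousLinearMap.integral_apply hex']
    rfl

open scoped Convolution in
/-- Mollifying `A` does not increase the bound on its exterior derivative: the curl of the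
mollified field is the mollification of the weak exterior derivative of `A`. -/
theorem abs_curl_convolution_le {d : ℕ} {A : Rd d → Rd d} (hA : Continuous A)
    {B : Rd d → Rd d [⋀^Fin 2]→L[ℝ] ℝ} {M : ℝ} (hB : ∀ᵐ x, ‖B x‖ ≤ M)
    (hAB : IsWeakExtDeriv A B) (φ : ContDiffBump (0 : Rd d)) (x v w : Rd d) :
    |⟪fderiv ℝ (φ.normed volume ⋆[ContinuousLinearMap.lsmul ℝ ℝ, volume] A) x v, w⟫_ℝ
      - ⟪fderiv ℝ (φ.normed volume ⋆[ContinuousLinearMap.lsmul ℝ ℝ, volume] A) x w, v⟫_ℝ|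
      ≤ M * ‖v‖ * ‖w‖ := by
  set f := φ.normed volume with hf
  have hfs : HasCompactSupport f := φ.hasCompactSupport_normed
  have hfd : ContDiff ℝ 1 f := φ.contDiff_normed
  set ψ : Rd d → ℝ := fun y => f (x - y) with hψ
  have hψt : IsTestFunction ψ := isTestFunction_normed_sub φ x
  have hψd : ∀ y v, fderiv ℝ ψ y v = - fderiv ℝ f (x - y) v := fun y v =>
    fderiv_sub_left_apply (hfd.differentiable one_ne_zero) x y v
  have hcψ : ∀ v, Continuous fun y => fderiv ℝ ψ y v := fun v =>
    (hψt.1.continuous_fderiv (by simp)).clm_apply continuous_const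
  have hsψ : ∀ v, HasCompactSupport fun y => fderiv ℝ ψ y v := fun v =>
    hψt.2.fderiv_apply ℝ v
  have key : ∀ v w, ⟪fderiv ℝ (f ⋆[ContinuousLinearMap.lsmul ℝ ℝ, volume] A) x v, w⟫_ℝ
      = - ∫ y, ⟪A y, w⟫_ℝ * fderiv ℝ ψ y v := by
    intro v w
    obtain ⟨hi, he⟩ := fderiv_convolution_apply hfs hfd hA.locallyIntegrable x v
    rw [he, real_inner_comm, ← integral_inner hi, ← integral_neg]
    congr 1
    ext y
    rw [hψd, inner_smul_right, real_inner_comm]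
    ring
  rw [key, key, neg_sub_neg, ← integral_sub]
  · have := hAB ψ hψt w v
    rw [this, abs_neg]
    have hb : ∀ᵐ y, ‖B y ![w, v] * ψ y‖ ≤ (M * ‖v‖ * ‖w‖) * ψ y := by
      filter_upwards [hB] with y hy
      have h0 : 0 ≤ ψ y := φ.nonneg_normed _
      rw [norm_mul, Real.norm_of_nonneg h0]
      gcongr
      refine ((B y).le_opNorm _).trans ?_
      rw [Fin.prod_univ_two]
      simp only [Matrix.cons_val_zero, Matrix.cons_val_one]
      rw [mul_assoc, mul_comm ‖v‖]
      gcongr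
    have hi : Integrable ψ := hψt.1.continuous.integrable_of_hasCompactSupport hψt.2
    refine (norm_integral_le_of_norm_le (hi.const_mul _) hb).trans_eq ?_
    rw [integral_const_mul, hψ, integral_sub_left_eq_self f, hf, φ.integral_normed, mul_one]
  · exact Continuous.integrable_of_hasCompactSupport ((by fun_prop : Continuous fun y =>
      ⟪A y, v⟫_ℝ).mul (hcψ w)) (hsψ w).mul_left
  · exact Continuous.integrable_of_hasCompactSupport ((by fun_prop : Continuous fun y =>
      ⟪A y, w⟫_ℝ).mul (hcψ v)) (hsψ v).mul_left

/-- A sequence of bump functions shrinking to the origin, with a fixed ratio of radii. -/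
theorem exists_bump_seq {d : ℕ} (r : ℕ → ℝ) (hr : ∀ n, 0 < r n) :
    ∃ φ : ℕ → ContDiffBump (0 : Rd d), (∀ n, (φ n).rOut = r n) ∧
      ∀ n, (φ n).rOut ≤ 2 * (φ n).rIn :=
  ⟨fun n => ⟨r n / 2, r n, by linarith [hr n], by linarith [hr n]⟩, fun _ => rfl,
    fun n => by simp only; linarith⟩

open scoped Convolution in
/-- The circulation of `A` along the boundary of a triangle is controlled by the bound on its weak
exterior derivative. -/
theorem abs_flux_le {d : ℕ} {A : Rd d → Rd d} (hA : Continuous A) {M : ℝ} (hM0 : 0 ≤ M)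
    {B : Rd d → Rd d [⋀^Fin 2]→L[ℝ] ℝ} (hB : ∀ᵐ x, ‖B x‖ ≤ M)
    (hAB : IsWeakExtDeriv A B) (x z y : Rd d) :
    |linePotential A x z + linePotential A z y - linePotential A x y|
      ≤ M * ‖z - x‖ * (‖y - x‖ + ‖z - x‖) := by
  obtain ⟨φ, hφ, -⟩ := exists_bump_seq (d := d) (fun n => 1 / ((n : ℝ) + 1))
    (fun n => by positivity)
  set An : ℕ → Rd d → Rd d := fun n =>
    (φ n).normed volume ⋆[ContinuousLinearMap.lsmul ℝ ℝ, volume] A with hAn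
  have hsm : ∀ n, ContDiff ℝ 1 (An n) := fun n =>
    (φ n).hasCompactSupport_normed.contDiff_convolution_left _ (φ n).contDiff_normed
      hA.locallyIntegrable
  have hrOut : Tendsto (fun n => (φ n).rOut) atTop (𝓝 0) := by
    simp only [hφ]
    exact tendsto_one_div_add_atTop_nhds_zero_nat
  have hlim : ∀ a b, Tendsto (fun n => linePotential (An n) a b) atTop
      (𝓝 (linePotential A a b)) := by
    intro a b
    obtain ⟨K, hK⟩ := (isCompact_closedBall (0 : Rd d) (‖a‖ + ‖b‖ + 1)).exists_bound_of_continuousOn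
      hA.continuousOn
    refine intervalIntegral.tendsto_integral_filter_of_dominated_convergence
      (fun _ => K * ‖b - a‖) ?_ ?_ intervalIntegrable_const ?_
    · refine Eventually.of_forall fun n => Continuous.aestronglyMeasurable ?_
      have := (hsm n).continuous
      fun_prop
    · refine Eventually.of_forall fun n => Eventually.of_forall fun t ht => ?_
      rw [Set.uIoc_of_le zero_le_one] at ht
      refine (norm_inner_le_norm _ _).trans ?_
      gcongr
      have hp : ‖(1 - t) • a + t • b‖ ≤ ‖a‖ + ‖b‖ := by
        refine (norm_add_le _ _).trans ?_
        rw [norm_smul, norm_smul, Real.norm_of_nonneg ht.1.le,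
          Real.norm_of_nonneg (by linarith [ht.2])]
        gcongr
        · exact mul_le_of_le_one_left (norm_nonneg _) (by linarith [ht.1])
        · exact mul_le_of_le_one_left (norm_nonneg _) ht.2
      have hball : ∀ q ∈ Metric.ball ((1 - t) • a + t • b) (φ n).rOut, ‖A q‖ ≤ K := by
        intro q hq
        apply hK
        rw [mem_closedBall_zero_iff]
        rw [hφ, Metric.mem_ball, dist_eq_norm] at hq
        have h1 : 1 / ((n : ℝ) + 1) ≤ 1 := by
          rw [div_le_one (by positivity)]
          linarith [(Nat.cast_nonneg n : (0 : ℝ) ≤ n)]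
        have := norm_add_le (q - ((1 - t) • a + t • b)) ((1 - t) • a + t • b)
        rw [sub_add_cancel] at this
        linarith
      have := dist_convolution_le (μ := volume) (g := A) (z₀ := (0 : Rd d)) (ε := K)
        ((norm_nonneg _).trans (hball _ (Metric.mem_ball_self (φ n).rOut_pos)))
        (φ n).support_normed_eq.subset (φ n).nonneg_normed (φ n).integral_normed
        hA.aestronglyMeasurable (fun q hq => by simpa using hball q hq)
      simpa using this
    · refine Eventually.of_forall fun t _ => ?_
      exact (ContDiffBump.convolution_tendsto_right_of_continuous hrOut hA _).inner
        tendsto_const_nhds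
  refine le_of_tendsto (((hlim x z).add (hlim z y)).sub (hlim x y)).abs
    (Eventually.of_forall fun n => ?_)
  exact abs_flux_le_of_contDiff (hsm n)
    (fun q v w => abs_curl_convolution_le hA hB hAB (φ n) q v w) hM0 x z y

/-! ### Weighted Jensen and Young inequalities -/

/-- Jensen's inequality for the power `p`, with respect to the measure of density `k`. -/
theorem lintegral_mul_rpow_le {α : Type*} [MeasurableSpace α] {μ : Measure α} {k f : α → ℝ≥0∞}
    (hk : AEMeasurable k μ) (hf : AEMeasurable f μ) {p : ℝ} (hp : 1 ≤ p) :
    (∫⁻ a, k a * f a ∂μ) ^ p ≤ (∫⁻ a, k a ∂μ) ^ (p - 1) * ∫⁻ a, k a * f a ^ p ∂μ := by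
  have hp0 : 0 < p := by linarith
  have hf' : AEMeasurable f (μ.withDensity k) :=
    hf.mono_ac (withDensity_absolutelyContinuous μ k)
  have h := eLpNorm'_le_eLpNorm'_mul_rpow_measure_univ (μ := μ.withDensity k) (f := f)
    one_pos hp hf'.aestronglyMeasurable
  simp only [eLpNorm', enorm_eq_self, ENNReal.rpow_one, div_one] at h
  have e1 := lintegral_withDensity_eq_lintegral_mul₀ hk hf
  have e2 := lintegral_withDensity_eq_lintegral_mul₀ hk (hf.pow_const p)
  simp only [Pi.mul_apply] at e1 e2
  rw [withDensity_apply _ MeasurableSet.univ, Measure.restrict_univ, e1, e2] at h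
  refine (ENNReal.rpow_le_rpow h hp0.le).trans_eq ?_
  rw [ENNReal.mul_rpow_of_nonneg _ _ hp0.le, ← ENNReal.rpow_mul, ← ENNReal.rpow_mul, mul_comm,
    one_div_mul_cancel hp0.ne', ENNReal.rpow_one]
  congr 2
  field_simp

theorem lintegral_lintegral_sub_mul {d : ℕ} {k g : Rd d → ℝ≥0∞} (hk : Measurable k)
    (hg : AEMeasurable g volume) :
    ∫⁻ x, ∫⁻ y, k (y - x) * g y = (∫⁻ z, k z) * ∫⁻ y, g y := by
  rw [lintegral_lintegral_swap]
  · rw [← lintegral_const_mul'' _ hg]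
    refine lintegral_congr fun y => ?_
    rw [lintegral_mul_const _ (by fun_prop), lintegral_sub_left_eq_self k]
  · exact (by fun_prop : Measurable fun q : Rd d × Rd d => k (q.2 - q.1)).aemeasurable.mul
      hg.comp_snd

/-- Young's convolution inequality `L¹ * L^p ⊂ L^p` for nonnegative functions. -/
theorem lintegral_rpow_lintegral_sub_mul_le {d : ℕ} {k g : Rd d → ℝ≥0∞} (hk : Measurable k)
    (hg : AEMeasurable g volume) {p : ℝ} (hp : 1 ≤ p) :
    ∫⁻ x, (∫⁻ y, k (y - x) * g y) ^ p ≤ (∫⁻ z, k z) ^ p * ∫⁻ y, g y ^ p := by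
  have hm : ∀ x : Rd d, Measurable fun y => k (y - x) := fun x => by fun_prop
  calc ∫⁻ x, (∫⁻ y, k (y - x) * g y) ^ p
      ≤ ∫⁻ x, (∫⁻ z, k z) ^ (p - 1) * ∫⁻ y, k (y - x) * g y ^ p := by
        refine lintegral_mono fun x => ?_
        refine (lintegral_mul_rpow_le (hm x).aemeasurable hg hp).trans_eq ?_
        rw [lintegral_sub_right_eq_self k]
    _ = (∫⁻ z, k z) ^ (p - 1) * ∫⁻ x, ∫⁻ y, k (y - x) * g y ^ p := by
        refine lintegral_const_mul'' _ (AEMeasurable.lintegral_prod_right'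
          (f := fun q : Rd d × Rd d => k (q.2 - q.1) * g q.2 ^ p) ?_)
        exact (by fun_prop : Measurable fun q : Rd d × Rd d => k (q.2 - q.1)).aemeasurable.mul
          (hg.pow_const p).comp_snd
    _ = (∫⁻ z, k z) ^ p * ∫⁻ y, g y ^ p := by
        rw [lintegral_lintegral_sub_mul hk (hg.pow_const p), ← mul_assoc]
        congr 1
        conv_lhs => rw [← ENNReal.rpow_one (∫⁻ z, k z)]
        rw [← ENNReal.rpow_mul, one_mul, ← ENNReal.rpow_add_of_nonneg _ _ (by linarith) zero_le_one]
        simp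

/-! ### Magnetic translations -/

/-- The magnetic translation by `h`: translation by `h` composed with the gauge factor
`e^{i I_A (x, x + h)}`. -/
def magneticTranslation {d : ℕ} (A : Rd d → Rd d) (h : Rd d) (u : Rd d → ℂ) (x : Rd d) : ℂ :=
  Complex.exp (Complex.I * (linePotential A x (x + h) : ℂ)) * u (x + h)

theorem norm_exp_I_mul_ofReal (r : ℝ) : ‖Complex.exp (Complex.I * (r : ℂ))‖ = 1 := by
  rw [mul_comm]; exact Complex.norm_exp_ofReal_mul_I r

theorem enorm_magneticTranslation {d : ℕ} (A : Rd d → Rd d) (h : Rd d) (u : Rd d → ℂ) (x : Rd d) :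
    ‖magneticTranslation A h u x‖ₑ = ‖u (x + h)‖ₑ := by
  rw [magneticTranslation, enorm_mul, ← ofReal_norm, norm_exp_I_mul_ofReal]
  simp

/-- The choice of the gauge factor: along a line, differentiating a magnetic translate amounts to
taking the covariant derivative. -/
theorem hasDerivAt_magneticTranslation {d : ℕ} {A : Rd d → Rd d} (hA : Continuous A)
    {u : Rd d → ℂ} {x h : Rd d} {τ : ℝ} {u' : ℂ}
    (hu : HasDerivAt (fun τ : ℝ => u (x + τ • h)) u' τ) :
    HasDerivAt (fun τ : ℝ => magneticTranslation A (τ • h) u x)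
      (Complex.exp (Complex.I * (linePotential A x (x + τ • h) : ℂ)) *
        (u' + Complex.I * (⟪A (x + τ • h), h⟫_ℝ : ℂ) * u (x + τ • h))) τ := by
  have h1 := (((hasDerivAt_linePotential hA x h τ).ofReal_comp).const_mul Complex.I).cexp
  simp only [magneticTranslation]
  refine (HasDerivAt.fun_mul h1 hu).congr_deriv ?_
  ring

/-- The fundamental theorem of calculus along a segment, in covariant form. -/
theorem enorm_magneticTranslation_sub_le {d : ℕ} {A : Rd d → Rd d} (hA : Continuous A)
    {w : Rd d → ℂ} (hw : ContDiff ℝ 1 w) (x h : Rd d) :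
    ‖magneticTranslation A h w x - w x‖ₑ ≤ ∫⁻ t in Set.Ioc (0 : ℝ) 1,
      ‖fderiv ℝ w (x + t • h) h + Complex.I * (⟪A (x + t • h), h⟫_ℝ : ℂ) * w (x + t • h)‖ₑ := by
  have hwc := hw.continuous
  have hDc : Continuous (fderiv ℝ w) := hw.continuous_fderiv one_ne_zero
  have hIc : Continuous fun τ : ℝ => linePotential A x (x + τ • h) :=
    continuous_linePotential hA (by fun_prop) (by fun_prop)
  have hd : ∀ τ : ℝ, HasDerivAt (fun τ : ℝ => w (x + τ • h)) (fderiv ℝ w (x + τ • h) h) τ := by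
    intro τ
    have hz : HasDerivAt (fun τ : ℝ => x + τ • h) h τ := by
      simpa using ((hasDerivAt_id τ).smul_const h).const_add x
    exact (hw.differentiable one_ne_zero _).hasFDerivAt.comp_hasDerivAt τ hz
  have key := intervalIntegral.integral_eq_sub_of_hasDerivAt (a := 0) (b := 1)
    (fun τ _ => hasDerivAt_magneticTranslation hA (hd τ))
    (Continuous.intervalIntegrable (by fun_prop) _ _)
  have h0 : magneticTranslation A ((0 : ℝ) • h) w x = w x := by
    simp [magneticTranslation, linePotential_self]
  rw [one_smul, h0] at key
  rw [← key, intervalIntegral.integral_of_le zero_le_one]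
  refine (enorm_integral_le_lintegral_enorm _).trans_eq (lintegral_congr fun t => ?_)
  rw [enorm_mul, ← ofReal_norm, norm_exp_I_mul_ofReal]
  simp

/-! ### Mollification of Sobolev functions -/

theorem locallyIntegrable_clm_comp {X E F : Type*} [TopologicalSpace X] [MeasurableSpace X]
    {μ : Measure X} [NormedAddCommGroup E] [NormedSpace ℂ E] [NormedAddCommGroup F]
    [NormedSpace ℂ F] (L : E →L[ℂ] F) {g : X → E} (hg : LocallyIntegrable g μ) :
    LocallyIntegrable (fun x => L (g x)) μ := fun x => by
  obtain ⟨s, hs, hi⟩ := hg x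
  exact ⟨s, hs, L.integrable_comp hi⟩

theorem norm_sum_ofReal_mul_le {d : ℕ} (h : Rd d) (c : EuclideanSpace ℂ (Fin d)) :
    ‖∑ j, (h j : ℂ) * c j‖ ≤ ‖h‖ * ‖c‖ := by
  set h' : EuclideanSpace ℂ (Fin d) := WithLp.toLp 2 fun j => (h j : ℂ) with hh'
  have h1 : ‖h'‖ = ‖h‖ := by simp [EuclideanSpace.norm_eq, hh']
  have h2 : inner ℂ h' c = ∑ j, (h j : ℂ) * c j := by
    simp [PiLp.inner_apply, hh', mul_comm]
  rw [← h2, ← h1]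
  exact norm_inner_le_norm _ _

open scoped Convolution in
/-- The gradient of a mollification is the mollification of the weak gradient. -/
theorem HasWeakGradient.fderiv_convolution {d : ℕ} {v : Rd d → ℂ}
    {G : Rd d → EuclideanSpace ℂ (Fin d)} (hG : HasWeakGradient v G) (φ : ContDiffBump (0 : Rd d)) (x h : Rd d) :
    fderiv ℝ (φ.normed volume ⋆[ContinuousLinearMap.lsmul ℝ ℝ, volume] v) x h
      = ∫ y, φ.normed volume (x - y) • ∑ j, (h j : ℂ) * G y j := by
  obtain ⟨hv, hGi, hw⟩ := hG
  set f := φ.normed volume with hf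
  have hfs : HasCompactSupport f := φ.hasCompactSupport_normed
  have hfd : ContDiff ℝ 1 f := φ.contDiff_normed
  set ψ : Rd d → ℝ := fun y => f (x - y) with hψ
  have hψt : IsTestFunction ψ := isTestFunction_normed_sub φ x
  have hψd : ∀ y v, fderiv ℝ f (x - y) v = - fderiv ℝ ψ y v := fun y v => by
    rw [hψ, fderiv_sub_left_apply (hfd.differentiable one_ne_zero), neg_neg]
  have hcψ : ∀ v, Continuous fun y => fderiv ℝ ψ y v := fun v =>
    (hψt.1.continuous_fderiv (by simp)).clm_apply continuous_const
  have hsψ : ∀ v, HasCompactSupport fun y => fderiv ℝ ψ y v := fun v =>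
    hψt.2.fderiv_apply ℝ v
  have hsum : ∀ y, fderiv ℝ ψ y h = ∑ j, h j * fderiv ℝ ψ y (EuclideanSpace.single j 1) := by
    intro y
    conv_lhs => rw [← (EuclideanSpace.basisFun (Fin d) ℝ).sum_repr h]
    simp
  have hGj : ∀ j, LocallyIntegrable (fun y => G y j) volume := fun j =>
    locallyIntegrable_clm_comp (EuclideanSpace.proj (𝕜 := ℂ) j) hGi
  rw [(fderiv_convolution_apply hfs hfd hv x h).2]
  simp only [hψd, hsum, neg_smul, integral_neg, Finset.sum_smul, Finset.smul_sum]
  rw [integral_finsetSum, integral_finsetSum, ← Finset.sum_neg_distrib]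
  · refine Finset.sum_congr rfl fun j _ => ?_
    simp only [mul_smul]
    rw [integral_smul, hw ψ hψt j, smul_neg, neg_neg, ← integral_smul]
    congr 1
    ext y
    simp only [Complex.real_smul]
    ring
  · intro j _
    have := (hGj j).integrable_smul_left_of_hasCompactSupport hψt.1.continuous hψt.2
    refine (this.const_mul (h j : ℂ)).congr (Eventually.of_forall fun y => ?_)
    simp only [Complex.real_smul]
    ring
  · intro j _
    have := hv.integrable_smul_left_of_hasCompactSupport (hcψ (EuclideanSpace.single j 1)) (hsψ _)
    refine (this.smul (h j)).congr (Eventually.of_forall fun y => ?_)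
    simp [mul_smul]

open scoped Convolution in
/-- The covariant derivative of a mollification is the mollification of the covariant gradient up to
a commutator, which is of order zero in `v` and proportional to the oscillation of `A`. -/
theorem HasWeakGradient.enorm_covariant_convolution_le {d : ℕ} {A : Rd d → Rd d} {v : Rd d → ℂ}
    {G : Rd d → EuclideanSpace ℂ (Fin d)}
    (hG : HasWeakGradient v G) (φ : ContDiffBump (0 : Rd d)) (x h : Rd d)
    (hosc : ∀ y ∈ Metric.ball x φ.rOut, ‖A x - A y‖ ≤ 1) :
    ‖fderiv ℝ (φ.normed volume ⋆[ContinuousLinearMap.lsmul ℝ ℝ, volume] v) x h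
      + Complex.I * (⟪A x, h⟫_ℝ : ℂ) *
        (φ.normed volume ⋆[ContinuousLinearMap.lsmul ℝ ℝ, volume] v) x‖ₑ
      ≤ ∫⁻ y, ENNReal.ofReal (φ.normed volume (-(y - x))) *
        (‖h‖ₑ * (‖v y‖ₑ + ‖covariantGradient A v G y‖ₑ)) := by
  set f := φ.normed volume with hf
  have hfs : HasCompactSupport f := φ.hasCompactSupport_normed
  have hfd : ContDiff ℝ 1 f := φ.contDiff_normed
  have hψc : Continuous fun y => f (x - y) := hfd.continuous.comp (by fun_prop)
  have hψs : HasCompactSupport fun y => f (x - y) := hfs.comp_homeomorph (Homeomorph.subLeft x)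
  have hGj : LocallyIntegrable (fun y => ∑ j, (h j : ℂ) * G y j) volume := by
    have := locallyIntegrable_clm_comp
      (∑ j, (h j : ℂ) • (EuclideanSpace.proj j : EuclideanSpace ℂ (Fin d) →L[ℂ] ℂ)) hG.2.1
    simpa [Function.comp_def] using this
  have hi1 := hGj.integrable_smul_left_of_hasCompactSupport hψc hψs
  have hi2 := hG.1.integrable_smul_left_of_hasCompactSupport hψc hψs
  rw [hG.fderiv_convolution φ x h, convolution_eq_swap]
  simp only [ContinuousLinearMap.lsmul_apply]
  rw [← integral_const_mul, ← integral_add hi1 (hi2.const_mul _)]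
  refine (enorm_integral_le_lintegral_enorm _).trans (lintegral_mono fun y => ?_)
  have e : f (x - y) • ∑ j, (h j : ℂ) * G y j + Complex.I * (⟪A x, h⟫_ℝ : ℂ) * (f (x - y) • v y)
      = f (x - y) • (∑ j, (h j : ℂ) * covariantGradient A v G y j
        + Complex.I * (⟪A x - A y, h⟫_ℝ : ℂ) * v y) := by
    have hin : ((⟪A x - A y, h⟫_ℝ : ℝ) : ℂ) = ⟪A x, h⟫_ℝ - ∑ j, (h j : ℂ) * (A y j : ℂ) := by
      rw [inner_sub_left, Complex.ofReal_sub, PiLp.inner_apply (A y)]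
      simp
    rw [hin]
    simp only [covariantGradient, mul_add, Finset.sum_add_distrib, Complex.real_smul]
    have : ∑ j, (h j : ℂ) * (Complex.I * (A y j : ℂ) * v y)
        = Complex.I * (∑ j, (h j : ℂ) * (A y j : ℂ)) * v y := by
      rw [Finset.mul_sum, Finset.sum_mul]
      exact Finset.sum_congr rfl fun j _ => by ring
    rw [this]
    ring
  rw [e, enorm_smul, neg_sub, Real.enorm_of_nonneg (φ.nonneg_normed _)]
  by_cases hy : y ∈ Metric.ball x φ.rOut
  · gcongr
    rw [← ofReal_norm, ← ofReal_norm, ← ofReal_norm, ← ofReal_norm,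
      ← ENNReal.ofReal_add (norm_nonneg _) (norm_nonneg _), ← ENNReal.ofReal_mul (norm_nonneg _)]
    apply ENNReal.ofReal_le_ofReal
    refine (norm_add_le _ _).trans ?_
    rw [mul_add, add_comm]
    gcongr
    · rw [norm_mul, norm_mul, Complex.norm_I, one_mul, Complex.norm_real]
      gcongr
      refine (norm_inner_le_norm _ _).trans (mul_le_of_le_one_left (norm_nonneg _) (hosc y hy))
    · exact norm_sum_ofReal_mul_le _ _
  · have : f (x - y) = 0 := by
      rw [← Function.notMem_support, φ.support_normed_eq, mem_ball_zero_iff]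
      rwa [Metric.mem_ball, dist_comm, dist_eq_norm] at hy
    rw [show φ.normed volume (x - y) = 0 from this, ENNReal.ofReal_zero, zero_mul]
    exact bot_le

open scoped Convolution in
/-- The estimate of `magneticTranslation A h w - w` for a mollification `w` of a function `v` with
weak gradient `G`, at a scale on which `A` oscillates by at most `1`. -/
theorem HasWeakGradient.lintegral_magneticTranslation_convolution_le {d : ℕ} {A : Rd d → Rd d}
    (hA : Continuous A) {v : Rd d → ℂ} {G : Rd d → EuclideanSpace ℂ (Fin d)}
    (hG : HasWeakGradient v G)
    (hcov : AEMeasurable (fun y => ‖v y‖ₑ + ‖covariantGradient A v G y‖ₑ) volume) {p : ℝ}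
    (hp : 1 ≤ p) (φ : ContDiffBump (0 : Rd d)) (h : Rd d) {R : ℝ}
    (hosc : ∀ x, ‖x‖ < R + ‖h‖ → ∀ y ∈ Metric.ball x φ.rOut, ‖A x - A y‖ ≤ 1) :
    ∫⁻ x in Metric.ball 0 R, ‖magneticTranslation A h
        (φ.normed volume ⋆[ContinuousLinearMap.lsmul ℝ ℝ, volume] v) x
        - (φ.normed volume ⋆[ContinuousLinearMap.lsmul ℝ ℝ, volume] v) x‖ₑ ^ p
      ≤ ‖h‖ₑ ^ p * ∫⁻ y, (‖v y‖ₑ + ‖covariantGradient A v G y‖ₑ) ^ p := by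
  have hp0 : 0 ≤ p := by linarith
  set w := φ.normed volume ⋆[ContinuousLinearMap.lsmul ℝ ℝ, volume] v with hw
  have hwd : ContDiff ℝ 1 w :=
    φ.hasCompactSupport_normed.contDiff_convolution_left _ φ.contDiff_normed hG.1
  have hwc := hwd.continuous
  have hDc : Continuous (fderiv ℝ w) := hwd.continuous_fderiv one_ne_zero
  set F : Rd d → ℂ := fun x => fderiv ℝ w x h + Complex.I * (⟪A x, h⟫_ℝ : ℂ) * w x with hF
  have hFc : Continuous F := by fun_prop
  set g : Rd d → ℝ≥0∞ := fun y => ‖h‖ₑ * (‖v y‖ₑ + ‖covariantGradient A v G y‖ₑ) with hg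
  have hgm : AEMeasurable g volume := hcov.const_mul _
  set k : Rd d → ℝ≥0∞ := fun z => ENNReal.ofReal (φ.normed volume (-z)) with hk
  have hkm : Measurable k := by
    have := (φ.contDiff_normed (μ := volume) (n := 0)).continuous
    exact (by fun_prop : Measurable k)
  have hk1 : ∫⁻ z, k z = 1 := by
    rw [hk, lintegral_neg_eq_self (fun z : Rd d => ENNReal.ofReal (φ.normed volume z)),
      ← ofReal_integral_eq_lintegral_ofReal φ.integrable_normed
        (Eventually.of_forall φ.nonneg_normed), φ.integral_normed, ENNReal.ofReal_one]
  calc ∫⁻ x in Metric.ball 0 R, ‖magneticTranslation A h w x - w x‖ₑ ^ p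
      ≤ ∫⁻ x in Metric.ball 0 R, ∫⁻ t in Set.Ioc (0 : ℝ) 1, ‖F (x + t • h)‖ₑ ^ p := by
        refine lintegral_mono fun x => ?_
        refine (ENNReal.rpow_le_rpow (enorm_magneticTranslation_sub_le hA hwd x h) hp0).trans ?_
        have := lintegral_mul_rpow_le (μ := volume.restrict (Set.Ioc (0 : ℝ) 1))
          (k := fun _ => 1) (f := fun t => ‖F (x + t • h)‖ₑ) aemeasurable_const
          (by fun_prop : Continuous fun t : ℝ => F (x + t • h)).measurable.enorm.aemeasurable hp
        simpa using this
    _ = ∫⁻ t in Set.Ioc (0 : ℝ) 1, ∫⁻ x in Metric.ball 0 R, ‖F (x + t • h)‖ₑ ^ p := by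
        refine lintegral_lintegral_swap (Measurable.aemeasurable ?_)
        have : Continuous fun q : Rd d × ℝ => F (q.1 + q.2 • h) := by fun_prop
        exact this.measurable.enorm.pow_const p
    _ ≤ ∫⁻ t in Set.Ioc (0 : ℝ) 1, ∫⁻ y, g y ^ p := by
        refine setLIntegral_mono' measurableSet_Ioc fun t ht => ?_
        calc ∫⁻ x in Metric.ball 0 R, ‖F (x + t • h)‖ₑ ^ p
            ≤ ∫⁻ x in Metric.ball 0 R, (∫⁻ y, k (y - (x + t • h)) * g y) ^ p := by
              refine setLIntegral_mono' measurableSet_ball fun x hx => ?_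
              refine ENNReal.rpow_le_rpow (hG.enorm_covariant_convolution_le φ _ h
                (hosc _ ?_)) hp0
              rw [mem_ball_zero_iff] at hx
              refine (norm_add_le _ _).trans_lt (add_lt_add_of_lt_of_le hx ?_)
              rw [norm_smul, Real.norm_of_nonneg ht.1.le]
              exact mul_le_of_le_one_left (norm_nonneg _) ht.2
          _ ≤ ∫⁻ x, (∫⁻ y, k (y - (x + t • h)) * g y) ^ p := setLIntegral_le_lintegral _ _
          _ = ∫⁻ x, (∫⁻ y, k (y - x) * g y) ^ p :=
              lintegral_add_right_eq_self (fun x => (∫⁻ y, k (y - x) * g y) ^ p) _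
          _ ≤ ∫⁻ y, g y ^ p := by
              simpa [hk1] using lintegral_rpow_lintegral_sub_mul_le hkm hgm hp
    _ = ‖h‖ₑ ^ p * ∫⁻ y, (‖v y‖ₑ + ‖covariantGradient A v G y‖ₑ) ^ p := by
        simp only [hg, ENNReal.mul_rpow_of_nonneg _ _ hp0, lintegral_const,
          Measure.restrict_apply_univ, Real.volume_Ioc]
        rw [lintegral_const_mul'' _ (hcov.pow_const p)]
        simp

theorem aestronglyMeasurable_covariantGradient {d : ℕ} {A : Rd d → Rd d}
    (hA : Continuous A) {v : Rd d → ℂ} {G : Rd d → EuclideanSpace ℂ (Fin d)}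
    (hv : AEStronglyMeasurable v volume) (hG : AEStronglyMeasurable G volume) :
    AEStronglyMeasurable (covariantGradient A v G) volume := by
  have e : covariantGradient A v G = fun x => G x +
      v x • (WithLp.toLp 2 fun j => Complex.I * (A x j : ℂ) : EuclideanSpace ℂ (Fin d)) := by
    ext x j
    simp [covariantGradient]
    ring
  rw [e]
  refine hG.add (hv.smul (Continuous.aestronglyMeasurable ?_))
  fun_prop

/-- Uniform continuity of `A` on bounded sets. -/
theorem exists_osc_le_one {d : ℕ} {A : Rd d → Rd d} (hA : Continuous A) (R : ℝ) {δ : ℝ}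
    (hδ : 0 < δ) (hδ1 : δ ≤ 1) :
    ∃ r, 0 < r ∧ r ≤ δ ∧ ∀ x, ‖x‖ < R → ∀ y ∈ Metric.ball x r, ‖A x - A y‖ ≤ 1 := by
  have hu := (isCompact_closedBall (0 : Rd d) (R + 1)).uniformContinuousOn_of_continuous
    hA.continuousOn
  rw [Metric.uniformContinuousOn_iff] at hu
  obtain ⟨r, hr, hr'⟩ := hu 1 one_pos
  refine ⟨min r δ, lt_min hr hδ, min_le_right _ _, fun x hx y hy => ?_⟩
  rw [Metric.mem_ball, lt_min_iff] at hy
  rw [← dist_eq_norm]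
  refine (hr' x ?_ y ?_ (by rw [dist_comm]; exact hy.1)).le
  · rw [mem_closedBall_zero_iff]; linarith
  · rw [mem_closedBall_zero_iff]
    have := norm_add_le (y - x) x
    rw [sub_add_cancel, ← dist_eq_norm] at this
    linarith [hy.2]

open scoped Convolution in
/-- Magnetic translations move functions of `W^{1,p}_A` by at most the length of the translation.
Only the continuity of `A` matters here. -/
theorem HasWeakGradient.lintegral_magneticTranslation_sub_le {d : ℕ} {A : Rd d → Rd d}
    (hA : Continuous A) {v : Rd d → ℂ} {G : Rd d → EuclideanSpace ℂ (Fin d)}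
    (hG : HasWeakGradient v G) {p : ℝ} (hp : 1 ≤ p) (h : Rd d) :
    ∫⁻ x, ‖magneticTranslation A h v x - v x‖ₑ ^ p
      ≤ ‖h‖ₑ ^ p * (2 ^ (p - 1) *
        ∫⁻ y, (‖v y‖ₑ ^ p + ‖covariantGradient A v G y‖ₑ ^ p)) := by
  have hp0 : 0 < p := by linarith
  have hcov : AEMeasurable (fun y => ‖v y‖ₑ + ‖covariantGradient A v G y‖ₑ) volume :=
    hG.1.aestronglyMeasurable.enorm.add
      (aestronglyMeasurable_covariantGradient hA hG.1.aestronglyMeasurable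
        hG.2.1.aestronglyMeasurable).enorm
  -- at step `n` the mollification scale is adapted to the oscillation of `A` on a ball of radius `n`
  have hr : ∀ n : ℕ, ∃ r, 0 < r ∧ r ≤ 1 / ((n : ℝ) + 1) ∧
      ∀ x, ‖x‖ < n + ‖h‖ → ∀ y ∈ Metric.ball x r, ‖A x - A y‖ ≤ 1 := fun n =>
    exists_osc_le_one hA _ (by positivity) (by
      rw [div_le_one (by positivity)]
      linarith [(Nat.cast_nonneg n : (0 : ℝ) ≤ n)])
  choose r hr0 hr1 hr2 using hr
  obtain ⟨φ, hφ, hφ2⟩ := exists_bump_seq (d := d) r hr0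
  have hrOut : Tendsto (fun n => (φ n).rOut) atTop (𝓝 0) := by
    simp only [hφ]
    exact squeeze_zero (fun n => (hr0 n).le) hr1 tendsto_one_div_add_atTop_nhds_zero_nat
  set w : ℕ → Rd d → ℂ := fun n =>
    (φ n).normed volume ⋆[ContinuousLinearMap.lsmul ℝ ℝ, volume] v with hw
  have hwc : ∀ n, Continuous (w n) := fun n =>
    ((φ n).hasCompactSupport_normed.contDiff_convolution_left (n := 0) _
      (φ n).contDiff_normed hG.1).continuous
  have hlim : ∀ᵐ x, Tendsto (fun n => w n x) atTop (𝓝 (v x)) :=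
    ContDiffBump.ae_convolution_tendsto_right_of_locallyIntegrable hrOut
      (Eventually.of_forall hφ2) hG.1
  have hlim' : ∀ᵐ x, Tendsto (fun n => w n (x + h)) atTop (𝓝 (v (x + h))) :=
    (eventually_add_right_iff volume h).2 hlim
  set f : ℕ → Rd d → ℝ≥0∞ := fun n => (Metric.ball 0 (n : ℝ)).indicator
    fun x => ‖magneticTranslation A h (w n) x - w n x‖ₑ ^ p with hf
  have hfm : ∀ n, Measurable (f n) := fun n => by
    have hIc : Continuous fun x : Rd d => linePotential A x (x + h) :=
      continuous_linePotential hA (by fun_prop) (by fun_prop)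
    have hwn := hwc n
    have : Continuous fun x => magneticTranslation A h (w n) x - w n x := by
      unfold magneticTranslation
      fun_prop
    exact (this.measurable.enorm.pow_const p).indicator measurableSet_ball
  have hflim : ∀ᵐ x, Tendsto (fun n => f n x) atTop
      (𝓝 (‖magneticTranslation A h v x - v x‖ₑ ^ p)) := by
    filter_upwards [hlim, hlim'] with x hx hx'
    have h1 : Tendsto (fun n => ‖magneticTranslation A h (w n) x - w n x‖ₑ ^ p) atTop
        (𝓝 (‖magneticTranslation A h v x - v x‖ₑ ^ p)) := by
      refine (ENNReal.continuous_rpow_const.tendsto _).comp ?_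
      exact ((hx'.const_mul _).sub hx).enorm
    refine h1.congr' ?_
    obtain ⟨N, hN⟩ := exists_nat_gt ‖x‖
    filter_upwards [eventually_ge_atTop N] with n hn
    have : x ∈ Metric.ball (0 : Rd d) n := by
      rw [mem_ball_zero_iff]
      exact hN.trans_le (by exact_mod_cast hn)
    rw [hf]
    simp only
    rw [Set.indicator_of_mem this]
  calc ∫⁻ x, ‖magneticTranslation A h v x - v x‖ₑ ^ p
      = ∫⁻ x, liminf (fun n => f n x) atTop := by
        refine lintegral_congr_ae ?_
        filter_upwards [hflim] with x hx
        exact hx.liminf_eq.symm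
    _ ≤ liminf (fun n => ∫⁻ x, f n x) atTop := lintegral_liminf_le hfm
    _ ≤ ‖h‖ₑ ^ p * ∫⁻ y, (‖v y‖ₑ + ‖covariantGradient A v G y‖ₑ) ^ p := by
        refine liminf_le_of_le (by isBoundedDefault) fun b hb => ?_
        obtain ⟨n, hn⟩ := hb.exists
        refine hn.trans ?_
        rw [hf, lintegral_indicator measurableSet_ball]
        exact hG.lintegral_magneticTranslation_convolution_le hA hcov hp (φ n) h
          (by rw [hφ]; exact hr2 n)
    _ ≤ _ := by
        gcongr
        rw [← lintegral_const_mul' _ _ (ENNReal.rpow_ne_top_of_nonneg (by linarith) (by simp))]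
        exact lintegral_mono fun y => ENNReal.rpow_add_le_mul_rpow_add_rpow _ _ hp

/-! ### Control of the fractional norm by the interpolation norm -/

theorem lpNorm_eq {d : ℕ} {p : ℝ} (hp : 1 ≤ p) (u : L0 d) :
    lpNorm p u = (∫⁻ x, ‖u x‖ₑ ^ p) ^ (1 / p) := by
  rw [lpNorm, eLpNorm_eq_lintegral_rpow_enorm_toReal (by simp; linarith) (by simp),
    ENNReal.toReal_ofReal (by linarith)]

theorem lpNorm_rpow {d : ℕ} {p : ℝ} (hp : 1 ≤ p) (u : L0 d) :
    lpNorm p u ^ p = ∫⁻ x, ‖u x‖ₑ ^ p := by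
  rw [lpNorm_eq hp, ← ENNReal.rpow_mul, one_div_mul_cancel (by linarith), ENNReal.rpow_one]

theorem lpNorm_le_sobolevNorm {d : ℕ} (A : Rd d → Rd d) {p : ℝ} (hp : 1 ≤ p) (u : L0 d) :
    lpNorm p u ≤ sobolevNorm A p u := by
  refine le_iInf₂ fun G _ => ?_
  rw [lpNorm_eq hp]
  gcongr
  exact le_self_add

theorem lpNorm_add_le {d : ℕ} {p : ℝ} (hp : 1 ≤ p) (u v : L0 d) :
    lpNorm p (u + v) ≤ lpNorm p u + lpNorm p v := by
  unfold lpNorm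
  rw [eLpNorm_congr_ae (AEEqFun.coeFn_add u v)]
  exact eLpNorm_add_le u.aestronglyMeasurable v.aestronglyMeasurable (by simpa using hp)

theorem magneticTranslation_congr_ae {d : ℕ} (A : Rd d → Rd d) (h : Rd d) {u v : Rd d → ℂ}
    (huv : u =ᵐ[volume] v) :
    magneticTranslation A h u =ᵐ[volume] magneticTranslation A h v := by
  filter_upwards [(eventually_add_right_iff volume h).2 huv] with x hx
  simp only [magneticTranslation, hx]

theorem measurable_magneticTranslation {d : ℕ} {A : Rd d → Rd d} (hA : Continuous A)
    {u : Rd d → ℂ} (hu : Measurable u) {X : Type*} [MeasurableSpace X] {f g : X → Rd d}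
    (hf : Measurable f) (hg : Measurable g) :
    Measurable fun q => magneticTranslation A (f q) u (g q) := by
  have h1 : Continuous fun q : Rd d × Rd d => linePotential A q.1 q.2 :=
    continuous_linePotential hA continuous_fst continuous_snd
  have h2 : Measurable fun q => linePotential A (g q) (g q + f q) :=
    Continuous.measurable2 (c := linePotential A) h1 hg (hg.add hf)
  unfold magneticTranslation
  fun_prop

/-- The modulus of continuity of `u` with respect to magnetic translations is controlled by
Peetre's functional. -/
theorem eLpNorm_magneticTranslation_sub_le {d : ℕ} {A : Rd d → Rd d} (hA : Continuous A) {p : ℝ}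
    (hp : 1 ≤ p) (h : Rd d) (u : L0 d) :
    eLpNorm (magneticTranslation A h u - ⇑u) (ENNReal.ofReal p) volume
      ≤ 2 * peetreK (lpNorm p) (sobolevNorm A p) ‖h‖ u := by
  have hp0 : 0 < p := by linarith
  have hp' : 1 ≤ ENNReal.ofReal p := by simpa using hp
  have hform : ∀ f : Rd d → ℂ, eLpNorm f (ENNReal.ofReal p) volume
      = (∫⁻ x, ‖f x‖ₑ ^ p) ^ (1 / p) := fun f => by
    rw [eLpNorm_eq_lintegral_rpow_enorm_toReal (by simp; linarith) (by simp),
      ENNReal.toReal_ofReal hp0.le]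
  have hm : ∀ v : L0 d, AEStronglyMeasurable (magneticTranslation A h v) volume := fun v =>
    (measurable_magneticTranslation hA v.measurable measurable_const
      measurable_id).aestronglyMeasurable
  unfold peetreK
  simp only [ENNReal.mul_iInf_of_ne two_ne_zero ENNReal.ofNat_ne_top]
  refine le_iInf fun a₀ => le_iInf fun a₁ => le_iInf fun ha => ?_
  subst ha
  have hsplit : magneticTranslation A h ⇑(a₀ + a₁) - ⇑(a₀ + a₁) =ᵐ[volume]
      (magneticTranslation A h a₀ - ⇑a₀) + (magneticTranslation A h a₁ - ⇑a₁) := by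
    filter_upwards [AEEqFun.coeFn_add a₀ a₁,
      magneticTranslation_congr_ae A h (AEEqFun.coeFn_add a₀ a₁)] with x hx hx'
    simp only [Pi.sub_apply, Pi.add_apply, hx, hx']
    simp only [Pi.add_apply, magneticTranslation]
    ring
  have h0 : eLpNorm (magneticTranslation A h a₀ - ⇑a₀) (ENNReal.ofReal p) volume
      ≤ 2 * lpNorm p a₀ := by
    refine (eLpNorm_sub_le (hm a₀) a₀.aestronglyMeasurable hp').trans_eq ?_
    rw [two_mul]
    congr 1
    rw [hform, lpNorm_eq hp]
    simp only [enorm_magneticTranslation]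
    rw [lintegral_add_right_eq_self (fun x => ‖a₀ x‖ₑ ^ p)]
  have h1 : eLpNorm (magneticTranslation A h a₁ - ⇑a₁) (ENNReal.ofReal p) volume
      ≤ 2 * (ENNReal.ofReal ‖h‖ * sobolevNorm A p a₁) := by
    -- `h = 0` is apart, since `0 * ∞ = 0` when `a₁` has no weak gradient
    rcases eq_or_ne h 0 with rfl | hh
    · have : magneticTranslation A 0 a₁ - ⇑a₁ = 0 := by
        ext x
        simp [magneticTranslation, linePotential_self]
      simp [this]
    unfold sobolevNorm
    simp only [ENNReal.mul_iInf_of_ne two_ne_zero ENNReal.ofNat_ne_top,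
      ENNReal.mul_iInf_of_ne (by simpa using hh : ENNReal.ofReal ‖h‖ ≠ 0) ENNReal.ofReal_ne_top]
    refine le_iInf₂ fun G hG => ?_
    have h2 := ENNReal.rpow_le_rpow (hG.lintegral_magneticTranslation_sub_le hA hp h)
      (by positivity : 0 ≤ 1 / p)
    rw [ENNReal.mul_rpow_of_nonneg _ _ (by positivity),
      ENNReal.mul_rpow_of_nonneg _ _ (by positivity), ← ENNReal.rpow_mul, ← ENNReal.rpow_mul,
      mul_one_div_cancel hp0.ne', ENNReal.rpow_one] at h2
    rw [hform]
    refine h2.trans ?_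
    rw [ofReal_norm, mul_left_comm]
    gcongr
    calc (2 : ℝ≥0∞) ^ ((p - 1) * (1 / p)) ≤ 2 ^ (1 : ℝ) := by
          refine ENNReal.rpow_le_rpow_of_exponent_le one_le_two ?_
          rw [mul_one_div, div_le_one hp0]
          linarith
      _ = 2 := ENNReal.rpow_one _
  calc _ = _ := eLpNorm_congr_ae hsplit
    _ ≤ _ := eLpNorm_add_le ((hm a₀).sub a₀.aestronglyMeasurable)
        ((hm a₁).sub a₁.aestronglyMeasurable) hp'
    _ ≤ _ := add_le_add h0 h1
    _ = _ := by ring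

/-- Integration of a radial function in polar coordinates. -/
theorem lintegral_fun_norm {d : ℕ} (hd : 1 ≤ d) {f : ℝ → ℝ≥0∞} (hf : Measurable f) :
    ∫⁻ x : Rd d, f ‖x‖ = (volume : Measure (Rd d)).toSphere Set.univ *
      ∫⁻ r in Set.Ioi (0 : ℝ), ENNReal.ofReal (r ^ (d - 1)) * f r := by
  have : Nonempty (Fin d) := ⟨⟨0, hd⟩⟩
  calc ∫⁻ x : Rd d, f ‖x‖
      = ∫⁻ x : ({(0)}ᶜ : Set (Rd d)), f ‖x.1‖ ∂(volume.comap Subtype.val) := by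
        rw [lintegral_subtype_comap (measurableSet_singleton _).compl fun x : Rd d => f ‖x‖,
          restrict_compl_singleton]
    _ = ∫⁻ q, f q.2 ∂(volume : Measure (Rd d)).toSphere.prod (.volumeIoiPow (d - 1)) := by
        have := (volume : Measure (Rd d)).measurePreserving_homeomorphUnitSphereProd.lintegral_comp_emb
          (Homeomorph.measurableEmbedding _) (fun q => f q.2.1)
        simpa using this
    _ = (volume : Measure (Rd d)).toSphere Set.univ *
          ∫⁻ r : Set.Ioi (0 : ℝ), f r ∂.volumeIoiPow (d - 1) := by
        rw [lintegral_prod _ (by fun_prop)]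
        simp [mul_comm]
    _ = _ := by
        rw [Measure.volumeIoiPow, lintegral_withDensity_eq_lintegral_mul _ (by fun_prop)
          (by fun_prop), ← lintegral_subtype_comap measurableSet_Ioi]
        rfl

/-- The Gagliardo energy averages the increments of `u` under magnetic translations. -/
theorem gagliardoEnergy_eq {d : ℕ} {A : Rd d → Rd d} (hA : Continuous A) (s p : ℝ) (u : L0 d) :
    gagliardoEnergy A s p u = ∫⁻ h, (‖h‖ₑ ^ ((d : ℝ) + s * p))⁻¹ *
      ∫⁻ x, ‖magneticTranslation A h u x - u x‖ₑ ^ p := by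
  have hu : Measurable u := u.measurable
  have hm : Measurable fun q : Rd d × Rd d => ‖magneticTranslation A q.2 u q.1 - u q.1‖ₑ ^ p :=
    ((measurable_magneticTranslation hA hu measurable_snd measurable_fst).sub
      (by fun_prop)).enorm.pow_const p
  calc gagliardoEnergy A s p u
      = ∫⁻ x, ∫⁻ h, (‖h‖ₑ ^ ((d : ℝ) + s * p))⁻¹ * ‖magneticTranslation A h u x - u x‖ₑ ^ p := by
        refine lintegral_congr fun x => ?_
        rw [← lintegral_add_left_eq_self (fun y =>
          ‖Complex.exp (Complex.I * (linePotential A x y : ℂ)) * u y - u x‖ₑ ^ p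
            / ‖y - x‖ₑ ^ ((d : ℝ) + s * p)) x]
        refine lintegral_congr fun h => ?_
        rw [magneticTranslation, add_sub_cancel_left, div_eq_mul_inv, mul_comm]
    _ = ∫⁻ h, ∫⁻ x, (‖h‖ₑ ^ ((d : ℝ) + s * p))⁻¹ * ‖magneticTranslation A h u x - u x‖ₑ ^ p := by
        refine lintegral_lintegral_swap (Measurable.aemeasurable ?_)
        simp only [Function.uncurry_def]
        exact Measurable.mul (by fun_prop) hm
    _ = _ := by
        refine lintegral_congr fun h => lintegral_const_mul _ ?_
        exact ((measurable_magneticTranslation hA hu measurable_const measurable_id).sub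
          hu).enorm.pow_const p

theorem measurable_peetreK {V : Type*} [AddCommGroup V] (N₀ N₁ : V → ℝ≥0∞) (a : V) :
    Measurable fun t => peetreK N₀ N₁ t a := by
  refine Monotone.measurable fun t t' h => ?_
  unfold peetreK
  gcongr

/-- Here `r ^ (d - 1)` comes from polar coordinates, and turns the weight `r ^ (-d - s p)` into
`r ^ (-s p) / r`. -/
theorem gagliardoEnergy_le {d : ℕ} (hd : 1 ≤ d) {A : Rd d → Rd d} (hA : Continuous A) {s p : ℝ}
    (hp : 1 ≤ p) (u : L0 d) :
    gagliardoEnergy A s p u ≤ (volume : Measure (Rd d)).toSphere Set.univ * 2 ^ p *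
      ∫⁻ t in Set.Ioi (0 : ℝ), (ENNReal.ofReal (t ^ (-s)) *
        peetreK (lpNorm p) (sobolevNorm A p) t u) ^ p * ENNReal.ofReal (1 / t) := by
  have hp0 : 0 < p := by linarith
  set K := fun t => peetreK (lpNorm p) (sobolevNorm A p) t u with hK
  have hKm : Measurable K := measurable_peetreK _ _ _
  rw [gagliardoEnergy_eq hA]
  calc ∫⁻ h, (‖h‖ₑ ^ ((d : ℝ) + s * p))⁻¹ * ∫⁻ x, ‖magneticTranslation A h u x - u x‖ₑ ^ p
      ≤ ∫⁻ h : Rd d, (fun r => (ENNReal.ofReal r ^ ((d : ℝ) + s * p))⁻¹ * (2 * K r) ^ p) ‖h‖ := by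
        refine lintegral_mono fun h => ?_
        simp only
        rw [ofReal_norm]
        gcongr
        have := eLpNorm_magneticTranslation_sub_le hA hp h u
        rw [eLpNorm_eq_lintegral_rpow_enorm_toReal (by simp; linarith) (by simp),
          ENNReal.toReal_ofReal hp0.le, one_div, ENNReal.rpow_inv_le_iff hp0] at this
        exact this
    _ = _ := by
        rw [lintegral_fun_norm hd (f := fun r => (ENNReal.ofReal r ^ ((d : ℝ) + s * p))⁻¹ *
          (2 * K r) ^ p) (by fun_prop), mul_assoc]
        congr 1
        rw [← lintegral_const_mul' _ _ (ENNReal.rpow_ne_top_of_nonneg hp0.le (by simp))]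
        refine setLIntegral_congr_fun measurableSet_Ioi fun r hr => ?_
        have hr : 0 < r := hr
        rw [ENNReal.mul_rpow_of_nonneg _ _ hp0.le, ENNReal.mul_rpow_of_nonneg _ _ hp0.le,
          ENNReal.ofReal_rpow_of_pos hr, ← ENNReal.ofReal_inv_of_pos (by positivity),
          ENNReal.ofReal_rpow_of_pos (by positivity)]
        have e : ENNReal.ofReal (r ^ (d - 1)) * ENNReal.ofReal ((r ^ ((d : ℝ) + s * p))⁻¹)
            = ENNReal.ofReal ((r ^ (-s)) ^ p) * ENNReal.ofReal (1 / r) := by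
          rw [← ENNReal.ofReal_mul (by positivity), ← ENNReal.ofReal_mul (by positivity)]
          congr 1
          rw [← Real.rpow_natCast, ← Real.rpow_neg hr.le, ← Real.rpow_mul hr.le, one_div,
            ← Real.rpow_neg_one r, ← Real.rpow_add hr, ← Real.rpow_add hr, Nat.cast_sub hd]
          congr 1
          push_cast
          ring
        rw [← mul_assoc, e]
        ring

theorem lpNorm_le_peetreK {d : ℕ} (A : Rd d → Rd d) {p : ℝ} (hp : 1 ≤ p) {t : ℝ} (ht : 1 ≤ t)
    (u : L0 d) : lpNorm p u ≤ peetreK (lpNorm p) (sobolevNorm A p) t u := by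
  refine le_iInf fun a₀ => le_iInf fun a₁ => le_iInf fun ha => ?_
  subst ha
  refine (lpNorm_add_le hp _ _).trans ?_
  gcongr
  refine (lpNorm_le_sobolevNorm A hp a₁).trans (le_mul_of_one_le_left' ?_)
  simpa using ht

/-- For `t ≥ 1` Peetre's functional dominates `‖u‖_{L^p}`, so that integrating over `1 < t ≤ 2`
recovers the `L^p` norm. -/
theorem lpNorm_rpow_mul_le {d : ℕ} (A : Rd d → Rd d) {s p : ℝ} (hs : 0 ≤ s)
    (hp : 1 ≤ p) (u : L0 d) :
    lpNorm p u ^ p * (ENNReal.ofReal (2 ^ (-s)) ^ p * ENNReal.ofReal (1 / 2)) ≤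
      ∫⁻ t in Set.Ioi (0 : ℝ), (ENNReal.ofReal (t ^ (-s)) *
        peetreK (lpNorm p) (sobolevNorm A p) t u) ^ p * ENNReal.ofReal (1 / t) := by
  have hp0 : 0 < p := by linarith
  have hsub : Set.Ioc (1 : ℝ) 2 ⊆ Set.Ioi 0 := fun t ht => zero_lt_one.trans ht.1
  refine le_trans ?_ (lintegral_mono_set hsub)
  calc lpNorm p u ^ p * (ENNReal.ofReal (2 ^ (-s)) ^ p * ENNReal.ofReal (1 / 2))
      = ∫⁻ t in Set.Ioc (1 : ℝ) 2,
          lpNorm p u ^ p * (ENNReal.ofReal (2 ^ (-s)) ^ p * ENNReal.ofReal (1 / 2)) := by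
        rw [lintegral_const, Measure.restrict_apply_univ, Real.volume_Ioc]
        norm_num
    _ ≤ _ := by
        refine setLIntegral_mono' measurableSet_Ioc fun t ht => ?_
        have h0 : 0 < t := zero_lt_one.trans ht.1
        rw [← mul_assoc, mul_comm (lpNorm p u ^ p), ← ENNReal.mul_rpow_of_nonneg _ _ hp0.le]
        gcongr ?_ * ?_
        · gcongr ?_ ^ p
          gcongr ?_ * ?_
          · apply ENNReal.ofReal_le_ofReal
            exact Real.rpow_le_rpow_of_nonpos h0 ht.2 (by linarith)
          · exact lpNorm_le_peetreK A hp ht.1.le u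
        · apply ENNReal.ofReal_le_ofReal
          exact one_div_le_one_div_of_le h0 ht.2

theorem exists_fractionalNorm_le {d : ℕ} (hd : 1 ≤ d) {A : Rd d → Rd d} (hA : Continuous A)
    {s p : ℝ} (hs : 0 ≤ s) (hp : 1 ≤ p) :
    ∃ C : NNReal, ∀ u : L0 d, fractionalNorm A s p u
      ≤ C * interpolationNorm (lpNorm p) (sobolevNorm A p) s p u := by
  have hp0 : 0 < p := by linarith
  set c : ℝ≥0∞ := ENNReal.ofReal (2 ^ (-s)) ^ p * ENNReal.ofReal (1 / 2) with hc
  have hc0 : c ≠ 0 := by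
    refine mul_ne_zero ?_ (by simp)
    rw [ENNReal.ofReal_rpow_of_pos (by positivity)]
    simp only [ne_eq, ENNReal.ofReal_eq_zero, not_le]
    positivity
  have hc1 : c ≠ ⊤ := ENNReal.mul_ne_top
    (ENNReal.rpow_ne_top_of_nonneg hp0.le ENNReal.ofReal_ne_top) ENNReal.ofReal_ne_top
  set D : ℝ≥0∞ := c⁻¹ + (volume : Measure (Rd d)).toSphere Set.univ * 2 ^ p with hD
  have hDt : D ≠ ⊤ := ENNReal.add_ne_top.2 ⟨ENNReal.inv_ne_top.2 hc0,
    ENNReal.mul_ne_top (measure_ne_top _ _) (ENNReal.rpow_ne_top_of_nonneg hp0.le (by simp))⟩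
  refine ⟨(D ^ (1 / p)).toNNReal, fun u => ?_⟩
  rw [ENNReal.coe_toNNReal (ENNReal.rpow_ne_top_of_nonneg (by positivity) hDt), fractionalNorm,
    interpolationNorm, ← ENNReal.mul_rpow_of_nonneg _ _ (by positivity)]
  gcongr
  rw [hD, add_mul]
  gcongr
  · have := lpNorm_rpow_mul_le A hs hp u
    rw [← hc, ← ENNReal.le_div_iff_mul_le (Or.inl hc0) (Or.inl hc1)] at this
    rwa [mul_comm, ← div_eq_mul_inv]
  · exact gagliardoEnergy_le hd hA hp u

/-! ### Weak gradients of locally Lipschitz functions -/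

/-- A locally Lipschitz function coincides near each point of a given ball with a globally Lipschitz
one. -/
theorem exists_lipschitz_extension {d : ℕ} {g : Rd d → ℝ}
    (hg : ∀ R, ∃ K : NNReal, LipschitzOnWith K g (Metric.ball 0 R)) (R : ℝ) :
    ∃ (K : NNReal) (g' : Rd d → ℝ), LipschitzWith K g' ∧
      ∀ x ∈ Metric.ball (0 : Rd d) R, g' =ᶠ[𝓝 x] g := by
  obtain ⟨K, hK⟩ := hg R
  obtain ⟨g', hg', he⟩ := hK.extend_real
  exact ⟨K, g', hg', fun x hx => Filter.eventuallyEq_of_mem (Metric.isOpen_ball.mem_nhds hx)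
    fun y hy => (he hy).symm⟩

theorem ae_lineDifferentiableAt_of_locallyLipschitz {d : ℕ} {g : Rd d → ℝ}
    (hg : ∀ R, ∃ K : NNReal, LipschitzOnWith K g (Metric.ball 0 R)) (v : Rd d) :
    ∀ᵐ x, LineDifferentiableAt ℝ g x v := by
  have h : ∀ n : ℕ, ∀ᵐ x : Rd d, x ∈ Metric.ball (0 : Rd d) n → LineDifferentiableAt ℝ g x v := by
    intro n
    obtain ⟨K, g', hg', he⟩ := exists_lipschitz_extension hg n
    filter_upwards [hg'.ae_lineDifferentiableAt (μ := volume) v] with x hx hxn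
    exact hx.congr_of_eventuallyEq (he x hxn).symm
  filter_upwards [ae_all_iff.2 h] with x hx
  obtain ⟨n, hn⟩ := exists_nat_gt ‖x‖
  exact hx n (by simpa using hn)

theorem locallyIntegrable_lineDeriv_of_locallyLipschitz {d : ℕ} {g : Rd d → ℝ}
    (hg : ∀ R, ∃ K : NNReal, LipschitzOnWith K g (Metric.ball 0 R)) (v : Rd d) :
    LocallyIntegrable (fun x => lineDeriv ℝ g x v) volume := by
  intro x
  obtain ⟨K, g', hg', he⟩ := exists_lipschitz_extension hg (‖x‖ + 2)
  refine ⟨Metric.closedBall x 1, Metric.closedBall_mem_nhds x one_pos, ?_⟩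
  have h := (hg'.locallyIntegrable_lineDeriv (μ := volume) v).integrableOn_isCompact
    (isCompact_closedBall x 1)
  refine h.congr_fun (fun y hy => ?_) Metric.isClosed_closedBall.measurableSet
  refine (he y ?_).lineDeriv_eq
  rw [mem_ball_zero_iff]
  rw [Metric.mem_closedBall, dist_eq_norm] at hy
  have := norm_add_le (y - x) x
  rw [sub_add_cancel] at this
  linarith

theorem integral_mul_lineDeriv_of_locallyLipschitz {d : ℕ} {g : Rd d → ℝ}
    (hg : ∀ R, ∃ K : NNReal, LipschitzOnWith K g (Metric.ball 0 R)) {φ : Rd d → ℝ}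
    (hφ : IsTestFunction φ) (v : Rd d) :
    ∫ x, fderiv ℝ φ x v * g x = - ∫ x, φ x * lineDeriv ℝ g x v := by
  obtain ⟨R, hR⟩ := hφ.2.isBounded.subset_ball (0 : Rd d)
  obtain ⟨K, g', hg', he⟩ := exists_lipschitz_extension hg R
  obtain ⟨D, hD⟩ := ContDiff.lipschitzWith_of_hasCompactSupport hφ.2 hφ.1 (by simp)
  have key := hg'.integral_lineDeriv_mul_eq (μ := volume) hD hφ.2 v
  have e1 : ∀ x, lineDeriv ℝ φ x (-v) = - fderiv ℝ φ x v := fun x => by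
    rw [((hφ.1.differentiable (by simp)) x).lineDeriv_eq_fderiv, map_neg]
  have e2 : ∫ x, φ x * lineDeriv ℝ g x v = ∫ x, lineDeriv ℝ g' x v * φ x := by
    congr 1
    ext x
    by_cases hx : x ∈ tsupport φ
    · rw [(he x (hR hx)).lineDeriv_eq, mul_comm]
    · rw [image_eq_zero_of_notMem_tsupport hx]; simp
  rw [e2, key, ← integral_neg]
  congr 1
  ext x
  rw [e1, neg_mul, neg_neg]
  by_cases hx : x ∈ tsupport φ
  · rw [(he x (hR hx)).eq_of_nhds]
  · have : fderiv ℝ φ x = 0 :=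
      image_eq_zero_of_notMem_tsupport fun h => hx (tsupport_fderiv_subset ℝ h)
    simp [this]

/-- The vector of the partial derivatives of `f`, computed along lines. It is a junk value at the
points where `f` is not differentiable along one of the axes. -/
def lineGradient {d : ℕ} (f : Rd d → ℂ) (x : Rd d) : EuclideanSpace ℂ (Fin d) :=
  WithLp.toLp 2 fun j =>
    ((lineDeriv ℝ (fun x => (f x).re) x (EuclideanSpace.single j 1) : ℝ) : ℂ)
      + Complex.I * ((lineDeriv ℝ (fun x => (f x).im) x (EuclideanSpace.single j 1) : ℝ) : ℂ)

theorem locallyLipschitz_re {d : ℕ} {f : Rd d → ℂ}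
    (hf : ∀ R, ∃ K : NNReal, LipschitzOnWith K f (Metric.ball 0 R)) (R : ℝ) :
    ∃ K : NNReal, LipschitzOnWith K (fun x => (f x).re) (Metric.ball 0 R) := by
  obtain ⟨K, hK⟩ := hf R
  exact ⟨_, Complex.reCLM.lipschitz.comp_lipschitzOnWith hK⟩

theorem locallyLipschitz_im {d : ℕ} {f : Rd d → ℂ}
    (hf : ∀ R, ∃ K : NNReal, LipschitzOnWith K f (Metric.ball 0 R)) (R : ℝ) :
    ∃ K : NNReal, LipschitzOnWith K (fun x => (f x).im) (Metric.ball 0 R) := by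
  obtain ⟨K, hK⟩ := hf R
  exact ⟨_, Complex.imCLM.lipschitz.comp_lipschitzOnWith hK⟩

theorem ae_hasLineDerivAt_lineGradient {d : ℕ} {f : Rd d → ℂ}
    (hf : ∀ R, ∃ K : NNReal, LipschitzOnWith K f (Metric.ball 0 R)) (j : Fin d) :
    ∀ᵐ x, HasLineDerivAt ℝ f (lineGradient f x j) x (EuclideanSpace.single j 1) := by
  filter_upwards [ae_lineDifferentiableAt_of_locallyLipschitz (locallyLipschitz_re hf)
      (EuclideanSpace.single j 1), ae_lineDifferentiableAt_of_locallyLipschitz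
      (locallyLipschitz_im hf) (EuclideanSpace.single j 1)] with x h1 h2
  have h1' := h1.hasLineDerivAt
  have h2' := h2.hasLineDerivAt
  unfold HasLineDerivAt at h1' h2' ⊢
  have := h1'.ofReal_comp.add (h2'.ofReal_comp.const_mul Complex.I)
  refine this.congr_of_eventuallyEq (Eventually.of_forall fun t => ?_)
  simp only [Pi.add_apply]
  rw [mul_comm, Complex.re_add_im]

theorem continuous_of_locallyLipschitz {d : ℕ} {f : Rd d → ℂ}
    (hf : ∀ R, ∃ K : NNReal, LipschitzOnWith K f (Metric.ball 0 R)) : Continuous f := by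
  rw [continuous_iff_continuousAt]
  intro x
  obtain ⟨K, hK⟩ := hf (‖x‖ + 1)
  exact hK.continuousOn.continuousAt (Metric.isOpen_ball.mem_nhds (by simp))

theorem hasWeakGradient_lineGradient {d : ℕ} {f : Rd d → ℂ}
    (hf : ∀ R, ∃ K : NNReal, LipschitzOnWith K f (Metric.ball 0 R)) :
    HasWeakGradient f (lineGradient f) := by
  have hfc := continuous_of_locallyLipschitz hf
  have hre := locallyLipschitz_re hf
  have him := locallyLipschitz_im hf
  have hire := fun v => locallyIntegrable_lineDeriv_of_locallyLipschitz hre v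
  have hiim := fun v => locallyIntegrable_lineDeriv_of_locallyLipschitz him v
  refine ⟨hfc.locallyIntegrable, ?_, fun φ hφ j => ?_⟩
  · have hj : ∀ j, LocallyIntegrable (fun x => lineGradient f x j) volume := fun j x => by
      obtain ⟨s, hs, hs'⟩ := hire (EuclideanSpace.single j 1) x
      obtain ⟨r, hr, hr'⟩ := hiim (EuclideanSpace.single j 1) x
      refine ⟨s ∩ r, inter_mem hs hr, ?_⟩
      have h1 : IntegrableOn (fun x => lineDeriv ℝ (fun x => (f x).re) x
        (EuclideanSpace.single j 1)) (s ∩ r) volume := hs'.mono_set Set.inter_subset_left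
      have h2 : IntegrableOn (fun x => lineDeriv ℝ (fun x => (f x).im) x
        (EuclideanSpace.single j 1)) (s ∩ r) volume := hr'.mono_set Set.inter_subset_right
      exact h1.ofReal.add (h2.ofReal.const_mul Complex.I)
    have e : lineGradient f = fun x => ∑ j, lineGradient f x j •
        (EuclideanSpace.single j 1 : EuclideanSpace ℂ (Fin d)) := by
      ext x i
      simp [Pi.single_apply]
    rw [e]
    exact locallyIntegrable_finsetSum _ fun j _ =>
      locallyIntegrable_clm_comp (ContinuousLinearMap.toSpanSingleton ℂ
        (EuclideanSpace.single j 1 : EuclideanSpace ℂ (Fin d))) (hj j)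
  · set v : Rd d := EuclideanSpace.single j 1 with hv
    have hφc := hφ.1.continuous
    have hDc : Continuous fun x => fderiv ℝ φ x v :=
      (hφ.1.continuous_fderiv (by simp)).clm_apply continuous_const
    have hDs : HasCompactSupport fun x => fderiv ℝ φ x v := hφ.2.fderiv_apply ℝ v
    have i1 : Integrable (fun x => fderiv ℝ φ x v * (f x).re) :=
      (hDc.mul (Complex.continuous_re.comp hfc)).integrable_of_hasCompactSupport hDs.mul_right
    have i2 : Integrable (fun x => fderiv ℝ φ x v * (f x).im) :=
      (hDc.mul (Complex.continuous_im.comp hfc)).integrable_of_hasCompactSupport hDs.mul_right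
    have i3 : Integrable (fun x => φ x * lineDeriv ℝ (fun x => (f x).re) x v) :=
      (hire v).integrable_smul_left_of_hasCompactSupport hφc hφ.2
    have i4 : Integrable (fun x => φ x * lineDeriv ℝ (fun x => (f x).im) x v) :=
      (hiim v).integrable_smul_left_of_hasCompactSupport hφc hφ.2
    have e1 : ∫ x, fderiv ℝ φ x v • f x = ((∫ x, fderiv ℝ φ x v * (f x).re : ℝ) : ℂ)
        + Complex.I * ((∫ x, fderiv ℝ φ x v * (f x).im : ℝ) : ℂ) := by
      rw [← integral_complex_ofReal, ← integral_complex_ofReal, ← integral_const_mul,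
        ← integral_add i1.ofReal (i2.ofReal.const_mul _)]
      congr 1
      ext x
      rw [Complex.real_smul]
      nth_rewrite 1 [← Complex.re_add_im (f x)]
      push_cast
      ring
    have e2 : ∫ x, φ x • lineGradient f x j
        = ((∫ x, φ x * lineDeriv ℝ (fun x => (f x).re) x v : ℝ) : ℂ)
        + Complex.I * ((∫ x, φ x * lineDeriv ℝ (fun x => (f x).im) x v : ℝ) : ℂ) := by
      rw [← integral_complex_ofReal, ← integral_complex_ofReal, ← integral_const_mul,
        ← integral_add i3.ofReal (i4.ofReal.const_mul _)]
      congr 1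
      ext x
      simp [lineGradient, hv]
      ring
    rw [e1, e2, integral_mul_lineDeriv_of_locallyLipschitz hre hφ,
      integral_mul_lineDeriv_of_locallyLipschitz him hφ]
    push_cast
    ring

/-! ### A Lipschitz mollifier -/

/-- `ρ` is a continuous mollifier at scale `t`: a probability density supported in the ball of
radius `t`, with the natural bounds, up to the factor `c`, on its size and its Lipschitz constant. -/
structure IsMollifier {d : ℕ} (c t : ℝ) (ρ : Rd d → ℝ) : Prop where
  continuous : Continuous ρ
  nonneg : ∀ z, 0 ≤ ρ z
  le : ∀ z, ρ z ≤ c / t ^ d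
  eq_zero : ∀ z, t ≤ ‖z‖ → ρ z = 0
  lipschitz : ∀ z z', |ρ z - ρ z'| ≤ c / t ^ d / t * ‖z - z'‖
  integral_eq : ∫ z, ρ z = 1

theorem exists_isMollifier (d : ℕ) :
    ∃ c : ℝ, 0 < c ∧ ∀ t : ℝ, 0 < t → ∃ ρ : Rd d → ℝ, IsMollifier c t ρ := by
  set η : Rd d → ℝ := fun z => max 0 (1 - ‖z‖) with hη
  have hηc : Continuous η := by fun_prop
  have hη0 : ∀ z, 0 ≤ η z := fun z => le_max_left _ _
  have hη1 : ∀ z, η z ≤ 1 := fun z => max_le zero_le_one (by linarith [norm_nonneg z])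
  have hηz : ∀ z, 1 ≤ ‖z‖ → η z = 0 := fun z hz => max_eq_left (by linarith)
  have hηs : HasCompactSupport η := HasCompactSupport.intro (isCompact_closedBall (0 : Rd d) 1)
    fun z hz => hηz z (by rw [mem_closedBall_zero_iff, not_le] at hz; exact hz.le)
  have hηl : ∀ z z', |η z - η z'| ≤ ‖z - z'‖ := fun z z' => by
    refine le_trans ?_ (abs_norm_sub_norm_le z z')
    simp only [hη, max_comm (0 : ℝ)]
    refine (abs_max_sub_max_le_abs _ _ _).trans_eq ?_
    rw [sub_sub_sub_cancel_left, abs_sub_comm]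
  set m := ∫ z, η z with hm
  have hm0 : 0 < m := hηc.integral_pos_of_hasCompactSupport_nonneg_nonzero hηs hη0
    (x := 0) (by simp [hη])
  refine ⟨1 / m, by positivity, fun t ht => ⟨fun z => 1 / m / t ^ d * η (t⁻¹ • z), ?_⟩⟩
  refine ⟨by fun_prop, fun z => mul_nonneg (by positivity) (hη0 _),
    fun z => mul_le_of_le_one_right (by positivity) (hη1 _), fun z hz => ?_, fun z z' => ?_, ?_⟩
  · rw [hηz, mul_zero]
    rw [norm_smul, norm_inv, Real.norm_of_nonneg ht.le, ← div_eq_inv_mul, one_le_div ht]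
    exact hz
  · rw [← mul_sub, abs_mul, abs_of_nonneg (by positivity : 0 ≤ 1 / m / t ^ d), div_eq_mul_inv _ t,
      mul_assoc]
    gcongr
    refine (hηl _ _).trans_eq ?_
    rw [← smul_sub, norm_smul, norm_inv, Real.norm_of_nonneg ht.le]
  · rw [integral_const_mul, Measure.integral_comp_inv_smul_of_nonneg volume η ht.le]
    simp only [finrank_euclideanSpace, Fintype.card_fin, smul_eq_mul]
    rw [← hm]
    field_simp

/-! ### Magnetic mollification -/

/-- The gauge factor `e^{i I_A (x, y)}`. -/
def gaugeFactor {d : ℕ} (A : Rd d → Rd d) (x y : Rd d) : ℂ :=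
  Complex.exp (Complex.I * (linePotential A x y : ℂ))

theorem norm_gaugeFactor {d : ℕ} (A : Rd d → Rd d) (x y : Rd d) : ‖gaugeFactor A x y‖ = 1 :=
  norm_exp_I_mul_ofReal _

theorem norm_exp_I_mul_sub_le (a b : ℝ) :
    ‖Complex.exp (Complex.I * (a : ℂ)) - Complex.exp (Complex.I * (b : ℂ))‖ ≤ |a - b| := by
  have e : Complex.exp (Complex.I * (a : ℂ)) - Complex.exp (Complex.I * (b : ℂ))
      = Complex.exp (Complex.I * (b : ℂ)) * (Complex.exp (Complex.I * ((a - b : ℝ) : ℂ)) - 1) := by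
    rw [mul_sub, ← Complex.exp_add, mul_one]
    congr 2
    push_cast
    ring
  rw [e, norm_mul, norm_exp_I_mul_ofReal, one_mul]
  exact Real.norm_exp_I_mul_ofReal_sub_one_le

theorem norm_gaugeFactor_mul_sub_le {d : ℕ} (A : Rd d → Rd d) (x z y : Rd d) :
    ‖gaugeFactor A x z * gaugeFactor A z y - gaugeFactor A x y‖
      ≤ |linePotential A x z + linePotential A z y - linePotential A x y| := by
  have e : gaugeFactor A x z * gaugeFactor A z y = Complex.exp (Complex.I *
      ((linePotential A x z + linePotential A z y : ℝ) : ℂ)) := by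
    rw [gaugeFactor, gaugeFactor, ← Complex.exp_add]
    congr 1
    push_cast
    ring
  rw [e]
  exact norm_exp_I_mul_sub_le _ _

theorem continuous_gaugeFactor {d : ℕ} {A : Rd d → Rd d} (hA : Continuous A) {X : Type*}
    [TopologicalSpace X] {f g : X → Rd d} (hf : Continuous f) (hg : Continuous g) :
    Continuous fun q => gaugeFactor A (f q) (g q) := by
  have := continuous_linePotential hA hf hg
  unfold gaugeFactor
  fun_prop

/-- The average of `u` near `x`, with weight `ρ (y - x)`, after parallel transport of the values
`u y` to `x` along straight lines. -/
def magneticMollification {d : ℕ} (A : Rd d → Rd d) (ρ : Rd d → ℝ) (u : Rd d → ℂ) (x : Rd d) : ℂ :=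
  ∫ y, ρ (y - x) • (gaugeFactor A x y * u y)

/-- The normalized weight of the ball of radius `2 t`. -/
def ballKernel {d : ℕ} (t : ℝ) (z : Rd d) : ℝ≥0∞ :=
  (Metric.ball 0 (2 * t)).indicator (fun _ => ENNReal.ofReal (1 / t ^ d)) z

theorem locallyIntegrable_gaugeFactor_mul {d : ℕ} {A : Rd d → Rd d} (hA : Continuous A)
    {u : Rd d → ℂ} (hu : LocallyIntegrable u volume) (x : Rd d) :
    LocallyIntegrable (fun y => gaugeFactor A x y * u y) volume := by
  refine hu.mono ?_ (Eventually.of_forall fun y => ?_)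
  · exact (continuous_gaugeFactor hA continuous_const
      continuous_id).aestronglyMeasurable.mul hu.aestronglyMeasurable
  · rw [norm_mul, norm_gaugeFactor, one_mul]

theorem IsMollifier.integrable_smul {d : ℕ} {c t : ℝ} {ρ : Rd d → ℝ} (hρ : IsMollifier c t ρ)
    {f : Rd d → ℂ} (hf : LocallyIntegrable f volume) (x : Rd d) :
    Integrable (fun y => ρ (y - x) • f y) := by
  have hρs : HasCompactSupport ρ := HasCompactSupport.intro (isCompact_closedBall (0 : Rd d) t)
    fun z hz => hρ.eq_zero z (by rw [mem_closedBall_zero_iff, not_le] at hz; exact hz.le)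
  have hρc := hρ.continuous
  exact hf.integrable_smul_left_of_hasCompactSupport (by fun_prop : Continuous fun y => ρ (y - x))
    (hρs.comp_homeomorph (Homeomorph.subRight x))

theorem IsMollifier.integral_sub_smul {d : ℕ} {c t : ℝ} {ρ : Rd d → ℝ} (hρ : IsMollifier c t ρ)
    (x : Rd d) (a : ℂ) : ∫ y, ρ (y - x) • a = a := by
  rw [integral_smul_const, integral_sub_right_eq_self ρ, hρ.integral_eq, one_smul]

theorem IsMollifier.enorm_le {d : ℕ} {c t : ℝ} (ht : 0 < t) {ρ : Rd d → ℝ}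
    (hρ : IsMollifier c t ρ) (z : Rd d) : ‖ρ z‖ₑ ≤ ENNReal.ofReal c * ballKernel t z := by
  by_cases hz : ‖z‖ < 2 * t
  · rw [ballKernel, Set.indicator_of_mem (by simpa using hz), Real.enorm_of_nonneg (hρ.nonneg z),
      ← ENNReal.ofReal_mul' (by positivity), mul_one_div]
    exact ENNReal.ofReal_le_ofReal (hρ.le z)
  · rw [hρ.eq_zero z (by linarith)]
    simp

theorem enorm_magneticMollification_le {d : ℕ} (A : Rd d → Rd d) {c t : ℝ} (ht : 0 < t)
    {ρ : Rd d → ℝ} (hρ : IsMollifier c t ρ) (u : Rd d → ℂ) (x : Rd d) :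
    ‖magneticMollification A ρ u x‖ₑ
      ≤ ENNReal.ofReal c * ∫⁻ y, ballKernel t (y - x) * ‖u y‖ₑ := by
  rw [← lintegral_const_mul' _ _ ENNReal.ofReal_ne_top]
  refine (enorm_integral_le_lintegral_enorm _).trans (lintegral_mono fun y => ?_)
  rw [enorm_smul, enorm_mul, ← ofReal_norm (gaugeFactor A x y), norm_gaugeFactor,
    ENNReal.ofReal_one, one_mul, ← mul_assoc]
  gcongr
  exact hρ.enorm_le ht _

theorem enorm_magneticMollification_sub_le {d : ℕ} {A : Rd d → Rd d} (hA : Continuous A) {c t : ℝ}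
    (ht : 0 < t) {ρ : Rd d → ℝ} (hρ : IsMollifier c t ρ) {u : Rd d → ℂ}
    (hu : LocallyIntegrable u volume) (x : Rd d) :
    ‖magneticMollification A ρ u x - u x‖ₑ
      ≤ ENNReal.ofReal c * ∫⁻ y, ballKernel t (y - x) * ‖gaugeFactor A x y * u y - u x‖ₑ := by
  rw [← lintegral_const_mul' _ _ ENNReal.ofReal_ne_top]
  have e : magneticMollification A ρ u x - u x
      = ∫ y, ρ (y - x) • (gaugeFactor A x y * u y - u x) := by
    simp only [smul_sub]
    rw [integral_sub (hρ.integrable_smul (locallyIntegrable_gaugeFactor_mul hA hu x) x)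
      (hρ.integrable_smul (locallyIntegrable_const _) x), hρ.integral_sub_smul]
    rfl
  rw [e]
  refine (enorm_integral_le_lintegral_enorm _).trans (lintegral_mono fun y => ?_)
  rw [enorm_smul, ← mul_assoc]
  gcongr
  exact hρ.enorm_le ht _

/-- The covariant increments of a magnetic mollification. Since the mollifier has integral `1`, its
increments can be tested against `g_A (x, y) u y - u x` instead of `u y`; the flux bound controls
the defect in the composition of parallel transports. -/
theorem enorm_gaugeFactor_mul_magneticMollification_sub_le {d : ℕ} {A : Rd d → Rd d}
    (hA : Continuous A) {M : ℝ} (hM : 0 ≤ M)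
    (hfl : ∀ x z y, |linePotential A x z + linePotential A z y - linePotential A x y|
      ≤ M * ‖z - x‖ * (‖y - x‖ + ‖z - x‖)) {c t : ℝ} (hc : 0 ≤ c)
    (ht : 0 < t) {ρ : Rd d → ℝ} (hρ : IsMollifier c t ρ) {u : Rd d → ℂ}
    (hu : LocallyIntegrable u volume) {x z : Rd d} (hz : ‖z - x‖ ≤ t) :
    ‖gaugeFactor A x z * magneticMollification A ρ u z - magneticMollification A ρ u x‖ₑ
      ≤ ‖z - x‖ₑ * (ENNReal.ofReal c * ∫⁻ y, ballKernel t (y - x) *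
        (ENNReal.ofReal t⁻¹ * ‖gaugeFactor A x y * u y - u x‖ₑ
          + ENNReal.ofReal (6 * M * t) * ‖u y‖ₑ)) := by
  set J : Rd d → ℂ := fun y => (ρ (y - z) - ρ (y - x)) •
      (gaugeFactor A x z * gaugeFactor A z y * u y - u x) +
    ρ (y - x) • ((gaugeFactor A x z * gaugeFactor A z y - gaugeFactor A x y) * u y) with hJ
  have e : gaugeFactor A x z * magneticMollification A ρ u z - magneticMollification A ρ u x
      = ∫ y, J y := by
    have i1 := hρ.integrable_smul (locallyIntegrable_gaugeFactor_mul hA hu x) x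
    have i2 := (hρ.integrable_smul (locallyIntegrable_gaugeFactor_mul hA hu z) z).const_mul
      (gaugeFactor A x z)
    have i3 := hρ.integrable_smul (locallyIntegrable_const (u x)) x
    have i4 := hρ.integrable_smul (locallyIntegrable_const (u x)) z
    have e1 : J = fun y => (gaugeFactor A x z * (ρ (y - z) • (gaugeFactor A z y * u y))
        - ρ (y - x) • (gaugeFactor A x y * u y)) - (ρ (y - z) • u x - ρ (y - x) • u x) := by
      ext y
      simp only [hJ, Complex.real_smul]
      push_cast
      ring
    have i5 : Integrable (fun y => gaugeFactor A x z * (ρ (y - z) • (gaugeFactor A z y * u y))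
        - ρ (y - x) • (gaugeFactor A x y * u y)) := i2.sub i1
    have i6 : Integrable (fun y => ρ (y - z) • u x - ρ (y - x) • u x) := i4.sub i3
    rw [e1, integral_sub i5 i6, integral_sub i2 i1, integral_sub i4 i3,
      hρ.integral_sub_smul, hρ.integral_sub_smul, integral_const_mul, sub_self, sub_zero]
    rfl
  rw [e, ← lintegral_const_mul' _ _ ENNReal.ofReal_ne_top, ← lintegral_const_mul' _ _ enorm_ne_top]
  refine (enorm_integral_le_lintegral_enorm _).trans (lintegral_mono fun y => ?_)
  by_cases hy : ‖y - x‖ < 2 * t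
  · have hflux : ‖gaugeFactor A x z * gaugeFactor A z y - gaugeFactor A x y‖
        ≤ 3 * M * t * ‖z - x‖ := by
      refine (norm_gaugeFactor_mul_sub_le A x z y).trans ((hfl x z y).trans ?_)
      calc M * ‖z - x‖ * (‖y - x‖ + ‖z - x‖) ≤ M * ‖z - x‖ * (2 * t + t) := by gcongr
        _ = _ := by ring
    have hρd : |ρ (y - z) - ρ (y - x)| ≤ c / t ^ d / t * ‖z - x‖ := by
      refine (hρ.lipschitz _ _).trans_eq ?_
      rw [sub_sub_sub_cancel_left, norm_sub_rev]
    have h1 : ‖gaugeFactor A x z * gaugeFactor A z y * u y - u x‖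
        ≤ ‖gaugeFactor A x y * u y - u x‖ + 3 * M * t * t * ‖u y‖ := by
      have : gaugeFactor A x z * gaugeFactor A z y * u y - u x
          = (gaugeFactor A x y * u y - u x)
            + (gaugeFactor A x z * gaugeFactor A z y - gaugeFactor A x y) * u y := by ring
      rw [this]
      refine (norm_add_le _ _).trans ?_
      rw [norm_mul]
      gcongr
      exact hflux.trans (by gcongr)
    have hreal : ‖J y‖ ≤ ‖z - x‖ * (c * (1 / t ^ d *
        (t⁻¹ * ‖gaugeFactor A x y * u y - u x‖ + 6 * M * t * ‖u y‖))) := by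
      calc ‖J y‖ ≤ |ρ (y - z) - ρ (y - x)| * ‖gaugeFactor A x z * gaugeFactor A z y * u y - u x‖
            + ρ (y - x) * (‖gaugeFactor A x z * gaugeFactor A z y - gaugeFactor A x y‖ * ‖u y‖) := by
              refine (norm_add_le _ _).trans_eq ?_
              rw [norm_smul, norm_smul, norm_mul _ (u y), Real.norm_eq_abs,
                Real.norm_of_nonneg (hρ.nonneg _)]
        _ ≤ c / t ^ d / t * ‖z - x‖ *
              (‖gaugeFactor A x y * u y - u x‖ + 3 * M * t * t * ‖u y‖)
            + c / t ^ d * (3 * M * t * ‖z - x‖ * ‖u y‖) := by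
              gcongr
              exact hρ.le _
        _ = _ := by field_simp; ring
    rw [ballKernel, Set.indicator_of_mem (by simpa using hy), ← ofReal_norm (J y),
      ← ofReal_norm (z - x), ← ofReal_norm (u y), ← ofReal_norm (gaugeFactor A x y * u y - u x),
      ← ENNReal.ofReal_mul (by positivity), ← ENNReal.ofReal_mul (by positivity),
      ← ENNReal.ofReal_add (by positivity) (by positivity),
      ← ENNReal.ofReal_mul (by positivity), ← ENNReal.ofReal_mul hc,
      ← ENNReal.ofReal_mul (norm_nonneg _)]
    exact ENNReal.ofReal_le_ofReal hreal
  · -- here both kernels vanish, as `‖y - z‖ ≥ ‖y - x‖ - ‖z - x‖ ≥ t`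
    have h1 : ρ (y - x) = 0 := hρ.eq_zero _ (by linarith)
    have h2 : ρ (y - z) = 0 := by
      refine hρ.eq_zero _ ?_
      have := norm_add_le (y - z) (z - x)
      rw [sub_add_sub_cancel] at this
      linarith
    simp [hJ, h1, h2]

/-- The magnetic mollification is locally Lipschitz although `A` is only continuous: the
increment of `I_A (·, y)` from `x` to `z` is `-I_A (x, z)` up to a flux. -/
theorem locallyLipschitz_magneticMollification {d : ℕ} {A : Rd d → Rd d}
    (hA : Continuous A) {M : ℝ} (hM : 0 ≤ M)
    (hfl : ∀ x z y, |linePotential A x z + linePotential A z y - linePotential A x y|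
      ≤ M * ‖z - x‖ * (‖y - x‖ + ‖z - x‖)) {c t : ℝ} (hc : 0 ≤ c)
    (ht : 0 < t) {ρ : Rd d → ℝ} (hρ : IsMollifier c t ρ) {u : Rd d → ℂ}
    (hu : LocallyIntegrable u volume) (R : ℝ) :
    ∃ K : NNReal, LipschitzOnWith K (magneticMollification A ρ u) (Metric.ball 0 R) := by
  rcases le_or_gt R 0 with hR | hR
  · refine ⟨0, ?_⟩
    rw [Metric.ball_eq_empty.2 hR]
    exact lipschitzOnWith_empty _ _
  obtain ⟨K, hK⟩ := (isCompact_closedBall (0 : Rd d) R).exists_bound_of_continuousOn hA.continuousOn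
  have hK0 : 0 ≤ K := (norm_nonneg _).trans (hK 0 (by simp [hR.le]))
  set L : ℝ := c / t ^ d / t + c / t ^ d * (K + M * (4 * R + t)) with hL
  have hL0 : 0 ≤ L := by positivity
  set N : ℝ := ∫ y in Metric.closedBall (0 : Rd d) (R + t), ‖u y‖ with hN
  have hN0 : 0 ≤ N := integral_nonneg fun _ => norm_nonneg _
  have hui : IntegrableOn (fun y => ‖u y‖) (Metric.closedBall (0 : Rd d) (R + t)) volume :=
    (hu.integrableOn_isCompact (isCompact_closedBall _ _)).norm
  refine ⟨(L * N).toNNReal, LipschitzOnWith.of_dist_le_mul fun z hz x hx => ?_⟩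
  rw [Real.coe_toNNReal _ (by positivity), dist_eq_norm, dist_eq_norm]
  have hx' : ‖x‖ < R := by simpa using hx
  have hz' : ‖z‖ < R := by simpa using hz
  have i1 := hρ.integrable_smul (locallyIntegrable_gaugeFactor_mul hA hu x) x
  have i2 := hρ.integrable_smul (locallyIntegrable_gaugeFactor_mul hA hu z) z
  rw [magneticMollification, magneticMollification, ← integral_sub i2 i1]
  have hbound : ∀ y, ‖ρ (y - z) • (gaugeFactor A z y * u y) - ρ (y - x) • (gaugeFactor A x y * u y)‖
      ≤ (Metric.closedBall (0 : Rd d) (R + t)).indicator (fun y => L * ‖z - x‖ * ‖u y‖) y := by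
    intro y
    by_cases hy : ‖y‖ ≤ R + t
    · rw [Set.indicator_of_mem (by simpa using hy)]
      have hρd : |ρ (y - z) - ρ (y - x)| ≤ c / t ^ d / t * ‖z - x‖ := by
        refine (hρ.lipschitz _ _).trans_eq ?_
        rw [sub_sub_sub_cancel_left, norm_sub_rev]
      have hg : ‖gaugeFactor A z y - gaugeFactor A x y‖ ≤ (K + M * (4 * R + t)) * ‖z - x‖ := by
        refine (norm_exp_I_mul_sub_le _ _).trans ?_
        have h1 := abs_linePotential_le (convex_closedBall (0 : Rd d) R) hK
          (Metric.ball_subset_closedBall hx) (Metric.ball_subset_closedBall hz)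
        have h2 : M * ‖z - x‖ * (‖y - x‖ + ‖z - x‖) ≤ M * ‖z - x‖ * (4 * R + t) := by
          refine mul_le_mul_of_nonneg_left ?_ (by positivity)
          linarith [norm_sub_le y x, norm_sub_le z x]
        have h3 := abs_sub (linePotential A x z + linePotential A z y - linePotential A x y)
          (linePotential A x z)
        rw [show linePotential A x z + linePotential A z y - linePotential A x y
          - linePotential A x z = linePotential A z y - linePotential A x y by ring] at h3
        linarith [hfl x z y]
      have e : ρ (y - z) • (gaugeFactor A z y * u y) - ρ (y - x) • (gaugeFactor A x y * u y)
          = (ρ (y - z) - ρ (y - x)) • (gaugeFactor A z y * u y)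
            + ρ (y - x) • ((gaugeFactor A z y - gaugeFactor A x y) * u y) := by
        simp only [Complex.real_smul]
        push_cast
        ring
      rw [e]
      refine (norm_add_le _ _).trans ?_
      rw [norm_smul, norm_smul, norm_mul, norm_mul, norm_gaugeFactor, one_mul, Real.norm_eq_abs,
        Real.norm_of_nonneg (hρ.nonneg _)]
      calc _ ≤ c / t ^ d / t * ‖z - x‖ * ‖u y‖
            + c / t ^ d * ((K + M * (4 * R + t)) * ‖z - x‖ * ‖u y‖) := by
              gcongr
              exact hρ.le _
        _ = _ := by rw [hL]; ring
    · have hw : ∀ w : Rd d, ‖w‖ < R → ρ (y - w) = 0 := fun w hw => by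
        refine hρ.eq_zero _ ?_
        have := norm_add_le (y - w) w
        rw [sub_add_cancel] at this
        linarith
      rw [Set.indicator_of_notMem (by simpa using hy), hw x hx', hw z hz']
      simp
  refine (norm_integral_le_of_norm_le ?_ (Eventually.of_forall hbound)).trans_eq ?_
  · exact (integrable_indicator_iff Metric.isClosed_closedBall.measurableSet).2 (hui.const_mul _)
  · rw [integral_indicator Metric.isClosed_closedBall.measurableSet, integral_const_mul, ← hN]
    ring

/-- The covariant gradient of a magnetic mollification exists almost everywhere, and is bounded by
its covariant increments. -/
theorem ae_enorm_covariantGradient_le {d : ℕ} {A : Rd d → Rd d} (hA : Continuous A)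
    {f : Rd d → ℂ} (hf : ∀ R, ∃ K : NNReal, LipschitzOnWith K f (Metric.ball 0 R)) {t : ℝ}
    (ht : 0 < t) {g : Rd d → ℝ≥0∞}
    (hg : ∀ x z, ‖z - x‖ ≤ t → ‖gaugeFactor A x z * f z - f x‖ₑ ≤ ‖z - x‖ₑ * g x) :
    ∀ᵐ x, ‖covariantGradient A f (lineGradient f) x‖ₑ ≤ d * g x := by
  filter_upwards [ae_all_iff.2 (ae_hasLineDerivAt_lineGradient hf)] with x hx
  have hj : ∀ j, ‖covariantGradient A f (lineGradient f) x j‖ₑ ≤ g x := by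
    intro j
    rcases eq_or_ne (g x) ⊤ with h | h
    · rw [h]; exact le_top
    set v : Rd d := EuclideanSpace.single j 1 with hv
    have hvn : ‖v‖ = 1 := by simp [hv]
    have h0 : HasDerivAt (fun τ : ℝ => f (x + τ • v)) (lineGradient f x j) 0 := hx j
    have h1 := hasDerivAt_magneticTranslation hA h0
    have h2 : ‖Complex.exp (Complex.I * (linePotential A x (x + (0 : ℝ) • v) : ℂ)) *
        (lineGradient f x j + Complex.I * (⟪A (x + (0 : ℝ) • v), v⟫_ℝ : ℂ) * f (x + (0 : ℝ) • v))‖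
        ≤ (g x).toReal := by
      refine h1.le_of_lip' ENNReal.toReal_nonneg ?_
      filter_upwards [Metric.closedBall_mem_nhds (0 : ℝ) ht] with τ hτ
      have hτ' : ‖x + τ • v - x‖ = ‖τ‖ := by rw [add_sub_cancel_left, norm_smul, hvn, mul_one]
      have h3 := hg x (x + τ • v) (by
        rw [hτ']
        simpa using hτ)
      have h4 : magneticTranslation A ((0 : ℝ) • v) f x = f x := by
        simp [magneticTranslation, linePotential_self]
      rw [h4, sub_zero, mul_comm]
      have h5 : ‖magneticTranslation A (τ • v) f x - f x‖ₑ ≤ ‖τ‖ₑ * g x := by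
        refine h3.trans_eq ?_
        rw [← ofReal_norm, hτ', ofReal_norm]
      have h6 := ENNReal.toReal_mono (ENNReal.mul_ne_top enorm_ne_top h) h5
      simpa using h6
    have e : covariantGradient A f (lineGradient f) x j
        = lineGradient f x j + Complex.I * (⟪A x, v⟫_ℝ : ℂ) * f x := by
      simp [covariantGradient, hv, EuclideanSpace.inner_single_right]
    rw [norm_mul, norm_exp_I_mul_ofReal, one_mul, zero_smul, add_zero, ← e] at h2
    rw [← ofReal_norm]
    exact ENNReal.ofReal_le_of_le_toReal h2
  have hsum : ‖covariantGradient A f (lineGradient f) x‖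
      ≤ ∑ j, ‖covariantGradient A f (lineGradient f) x j‖ := by
    set w := covariantGradient A f (lineGradient f) x
    calc ‖w‖ = ‖∑ j, w j • (EuclideanSpace.single j 1 : EuclideanSpace ℂ (Fin d))‖ := by
          congr 1
          ext i
          simp [Pi.single_apply]
      _ ≤ _ := (norm_sum_le _ _).trans_eq (by simp [norm_smul])
  calc ‖covariantGradient A f (lineGradient f) x‖ₑ
      ≤ ∑ j, ‖covariantGradient A f (lineGradient f) x j‖ₑ := by
        rw [← ofReal_norm]
        refine (ENNReal.ofReal_le_ofReal hsum).trans_eq ?_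
        rw [ENNReal.ofReal_sum_of_nonneg fun _ _ => norm_nonneg _]
        simp only [ofReal_norm]
    _ ≤ ∑ _j : Fin d, g x := Finset.sum_le_sum fun j _ => hj j
    _ = d * g x := by simp

/-! ### Estimate of Peetre's functional -/

theorem measurable_ballKernel_uncurry {d : ℕ} :
    Measurable fun q : ℝ × Rd d => ballKernel q.1 q.2 := by
  have : (fun q : ℝ × Rd d => ballKernel q.1 q.2) = {q : ℝ × Rd d | ‖q.2‖ < 2 * q.1}.indicator
      fun q => ENNReal.ofReal (1 / q.1 ^ d) := by
    ext q
    by_cases hq : ‖q.2‖ < 2 * q.1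
    · rw [ballKernel, Set.indicator_of_mem (mem_ball_zero_iff.2 hq), Set.indicator_of_mem
        (by exact hq)]
    · rw [ballKernel, Set.indicator_of_notMem (fun h => hq (mem_ball_zero_iff.1 h)),
        Set.indicator_of_notMem (by exact hq)]
  rw [this]
  exact Measurable.indicator (by fun_prop) (measurableSet_lt (by fun_prop) (by fun_prop))

theorem measurable_ballKernel {d : ℕ} (t : ℝ) : Measurable (ballKernel (d := d) t) :=
  measurable_const.indicator measurableSet_ball

theorem lintegral_ballKernel {d : ℕ} {t : ℝ} (ht : 0 < t) :
    ∫⁻ z : Rd d, ballKernel t z = volume (Metric.ball (0 : Rd d) 2) := by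
  simp only [ballKernel]
  rw [lintegral_indicator measurableSet_ball, setLIntegral_const, mul_comm 2 t,
    Measure.addHaar_ball_mul_of_pos _ _ ht, finrank_euclideanSpace_fin, ← mul_assoc,
    ← ENNReal.ofReal_mul (by positivity), one_div_mul_cancel (by positivity), ENNReal.ofReal_one,
    one_mul]

/-- The `p`-th powers of the increments of `u` under the magnetic translations of length less
than `2 t`, averaged over the translations. -/
def averagedIncrement {d : ℕ} (A : Rd d → Rd d) (p : ℝ) (u : L0 d) (t : ℝ) : ℝ≥0∞ :=
  ∫⁻ h, ballKernel t h * ∫⁻ x, ‖magneticTranslation A h u x - u x‖ₑ ^ p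

theorem lintegral_ballKernel_mul_gaugeFactor {d : ℕ} (A : Rd d → Rd d) (u : Rd d → ℂ) (t : ℝ)
    (x : Rd d) :
    ∫⁻ y, ballKernel t (y - x) * ‖gaugeFactor A x y * u y - u x‖ₑ
      = ∫⁻ h, ballKernel t h * ‖magneticTranslation A h u x - u x‖ₑ := by
  rw [← lintegral_add_left_eq_self (fun y =>
    ballKernel t (y - x) * ‖gaugeFactor A x y * u y - u x‖ₑ) x]
  refine lintegral_congr fun h => ?_
  rw [add_sub_cancel_left]
  rfl

theorem measurable_enorm_magneticTranslation_sub {d : ℕ} {A : Rd d → Rd d} (hA : Continuous A)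
    {u : Rd d → ℂ} (hu : Measurable u) {X : Type*} [MeasurableSpace X] {f g : X → Rd d}
    (hf : Measurable f) (hg : Measurable g) :
    Measurable fun q => ‖magneticTranslation A (f q) u (g q) - u (g q)‖ₑ :=
  ((measurable_magneticTranslation hA hu hf hg).sub (hu.comp hg)).enorm

theorem measurable_lintegral_ballKernel_mul {d : ℕ} {A : Rd d → Rd d} (hA : Continuous A)
    {u : Rd d → ℂ} (hu : Measurable u) (t : ℝ) :
    Measurable fun x => ∫⁻ h, ballKernel t h * ‖magneticTranslation A h u x - u x‖ₑ :=
  Measurable.lintegral_prod_right (f := fun x h : Rd d =>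
      ballKernel t h * ‖magneticTranslation A h u x - u x‖ₑ)
    (((measurable_ballKernel t).comp measurable_snd).mul
      (measurable_enorm_magneticTranslation_sub hA hu measurable_snd measurable_fst))

theorem lintegral_rpow_average_le {d : ℕ} {A : Rd d → Rd d} (hA : Continuous A) {p : ℝ}
    (hp : 1 ≤ p) (u : L0 d) {t : ℝ} (ht : 0 < t) :
    ∫⁻ x, (∫⁻ h, ballKernel t h * ‖magneticTranslation A h u x - u x‖ₑ) ^ p
      ≤ volume (Metric.ball (0 : Rd d) 2) ^ (p - 1) * averagedIncrement A p u t := by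
  have hu : Measurable u := u.measurable
  have hk := measurable_ballKernel (d := d) t
  calc ∫⁻ x, (∫⁻ h, ballKernel t h * ‖magneticTranslation A h u x - u x‖ₑ) ^ p
      ≤ ∫⁻ x, volume (Metric.ball (0 : Rd d) 2) ^ (p - 1) *
          ∫⁻ h, ballKernel t h * ‖magneticTranslation A h u x - u x‖ₑ ^ p := by
        refine lintegral_mono fun x => ?_
        rw [← lintegral_ballKernel (d := d) ht]
        exact lintegral_mul_rpow_le hk.aemeasurable (measurable_enorm_magneticTranslation_sub hA hu
          measurable_id measurable_const).aemeasurable hp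
    _ = volume (Metric.ball (0 : Rd d) 2) ^ (p - 1) *
          ∫⁻ x, ∫⁻ h, ballKernel t h * ‖magneticTranslation A h u x - u x‖ₑ ^ p :=
        lintegral_const_mul' _ _ (ENNReal.rpow_ne_top_of_nonneg (by linarith)
          measure_ball_lt_top.ne)
    _ = _ := by
        rw [lintegral_lintegral_swap]
        · congr 1
          refine lintegral_congr fun h => lintegral_const_mul _ ?_
          exact (measurable_enorm_magneticTranslation_sub hA hu measurable_const
            measurable_id).pow_const p
        · simp only [Function.uncurry_def]
          exact ((hk.comp measurable_snd).mul ((measurable_enorm_magneticTranslation_sub hA hu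
            measurable_snd measurable_fst).pow_const p)).aemeasurable

theorem HasWeakGradient.congr_ae {d : ℕ} {u v : Rd d → ℂ} {G : Rd d → EuclideanSpace ℂ (Fin d)}
    (h : HasWeakGradient u G) (huv : u =ᵐ[volume] v) : HasWeakGradient v G := by
  refine ⟨h.1.congr huv, h.2.1, fun φ hφ j => ?_⟩
  rw [← h.2.2 φ hφ j]
  refine integral_congr_ae ?_
  filter_upwards [huv] with x hx
  rw [hx]

/-- Decomposing `u` into its magnetic mollification at scale `t` and the remainder. -/
theorem exists_peetreK_rpow_le {d : ℕ} {A : Rd d → Rd d} (hA : Continuous A) {M : ℝ} (hM : 0 ≤ M)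
    (hfl : ∀ x z y, |linePotential A x z + linePotential A z y - linePotential A x y|
      ≤ M * ‖z - x‖ * (‖y - x‖ + ‖z - x‖)) {p : ℝ} (hp : 1 ≤ p) :
    ∃ C₁ C₂ : NNReal, ∀ t : ℝ, 0 < t → t ≤ 1 → ∀ u : L0 d, LocallyIntegrable u volume →
      peetreK (lpNorm p) (sobolevNorm A p) t u ^ p ≤ C₁ * averagedIncrement A p u t
        + C₂ * (ENNReal.ofReal t ^ p * lpNorm p u ^ p) := by
  have hp0 : 0 < p := by linarith
  have hp1 : 0 ≤ p - 1 := by linarith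
  obtain ⟨c, hc, hker⟩ := exists_isMollifier d
  set a : ℝ≥0∞ := ENNReal.ofReal c with ha
  set b : ℝ≥0∞ := ENNReal.ofReal (6 * M) with hb
  set m : ℝ≥0∞ := volume (Metric.ball (0 : Rd d) 2) with hm
  have hap : a ^ p ≠ ⊤ := ENNReal.rpow_ne_top_of_nonneg hp0.le ENNReal.ofReal_ne_top
  have hbp : b ^ p ≠ ⊤ := ENNReal.rpow_ne_top_of_nonneg hp0.le ENNReal.ofReal_ne_top
  have hda : ((d : ℝ≥0∞) * a) ^ p ≠ ⊤ := ENNReal.rpow_ne_top_of_nonneg hp0.le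
    (ENNReal.mul_ne_top (by simp) ENNReal.ofReal_ne_top)
  have h2 : (2 : ℝ≥0∞) ^ (p - 1) ≠ ⊤ := ENNReal.rpow_ne_top_of_nonneg hp1 (by simp)
  have hm1 : m ^ (p - 1) ≠ ⊤ := ENNReal.rpow_ne_top_of_nonneg hp1 measure_ball_lt_top.ne
  have hm2 : m ^ p ≠ ⊤ := ENNReal.rpow_ne_top_of_nonneg hp0.le measure_ball_lt_top.ne
  set C₁ : ℝ≥0∞ := 2 ^ (p - 1) * ((a ^ p + (d * a) ^ p * 2 ^ (p - 1)) * m ^ (p - 1)) with hC₁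
  set C₂ : ℝ≥0∞ := 2 ^ (p - 1) * ((a ^ p + (d * a) ^ p * (2 ^ (p - 1) * b ^ p)) * m ^ p) with hC₂
  have hC₁t : C₁ ≠ ⊤ := by finiteness
  have hC₂t : C₂ ≠ ⊤ := by finiteness
  refine ⟨C₁.toNNReal, C₂.toNNReal, fun t ht ht1 u hu => ?_⟩
  rw [ENNReal.coe_toNNReal hC₁t, ENNReal.coe_toNNReal hC₂t]
  obtain ⟨ρ, hρ⟩ := hker t ht
  have hum : Measurable u := u.measurable
  set T : ℝ≥0∞ := ENNReal.ofReal t with hT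
  have hTp : T ^ p ≠ ⊤ := ENNReal.rpow_ne_top_of_nonneg hp0.le ENNReal.ofReal_ne_top
  set U : Rd d → ℂ := magneticMollification A ρ u with hU
  set P : Rd d → ℝ≥0∞ := fun x => ∫⁻ h, ballKernel t h * ‖magneticTranslation A h u x - u x‖ₑ
    with hP
  set Q : Rd d → ℝ≥0∞ := fun x => ∫⁻ y, ballKernel t (y - x) * ‖u y‖ₑ with hQ
  have hPm : Measurable P := measurable_lintegral_ballKernel_mul hA hum t
  have hQm : Measurable Q := by
    have hk := measurable_ballKernel (d := d) t
    exact Measurable.lintegral_prod_right (f := fun x y : Rd d => ballKernel t (y - x) * ‖u y‖ₑ)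
      (by fun_prop)
  have hPP : ∫⁻ x, P x ^ p ≤ m ^ (p - 1) * averagedIncrement A p u t :=
    lintegral_rpow_average_le hA hp u ht
  have hQQ : ∫⁻ x, Q x ^ p ≤ m ^ p * lpNorm p u ^ p := by
    rw [lpNorm_rpow hp, hm, ← lintegral_ballKernel (d := d) ht]
    exact lintegral_rpow_lintegral_sub_mul_le (measurable_ballKernel t) hum.enorm.aemeasurable hp
  have hUl := locallyLipschitz_magneticMollification hA hM hfl hc.le ht hρ hu
  have hUc : Continuous U := continuous_of_locallyLipschitz hUl
  -- pointwise bounds of `U - u`, `U` and of the covariant gradient of `U`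
  have b1 : ∀ x, ‖U x - u x‖ₑ ≤ a * P x := fun x => by
    rw [hP]
    simp only
    rw [← lintegral_ballKernel_mul_gaugeFactor]
    exact enorm_magneticMollification_sub_le hA ht hρ hu x
  have b2 : ∀ x, ‖U x‖ₑ ≤ a * Q x := fun x => enorm_magneticMollification_le A ht hρ u x
  have b3 : ∀ᵐ x, T * ‖covariantGradient A U (lineGradient U) x‖ₑ
      ≤ d * a * (P x + b * T * Q x) := by
    filter_upwards [ae_enorm_covariantGradient_le hA hUl ht (g := fun x => _) fun x z hz =>
      enorm_gaugeFactor_mul_magneticMollification_sub_le hA hM hfl hc.le ht hρ hu hz] with x hx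
    have hk : Measurable fun y => ballKernel t (y - x) :=
      (measurable_ballKernel t).comp (by fun_prop)
    have hg : Continuous fun y => gaugeFactor A x y :=
      continuous_gaugeFactor hA continuous_const continuous_id
    have e : ∫⁻ y, ballKernel t (y - x) * (ENNReal.ofReal t⁻¹ * ‖gaugeFactor A x y * u y - u x‖ₑ
        + ENNReal.ofReal (6 * M * t) * ‖u y‖ₑ) = ENNReal.ofReal t⁻¹ * P x + b * T * Q x := by
      simp only [mul_add, hP, hQ]
      rw [lintegral_add_left (by fun_prop), ← lintegral_ballKernel_mul_gaugeFactor,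
        ← lintegral_const_mul' _ _ ENNReal.ofReal_ne_top,
        ENNReal.ofReal_mul (by positivity : 0 ≤ 6 * M), ← hb, ← hT,
        ← lintegral_const_mul' (b * T) _ (ENNReal.mul_ne_top ENNReal.ofReal_ne_top
          ENNReal.ofReal_ne_top)]
      congr 1 <;> refine lintegral_congr fun y => ?_ <;> ring
    rw [e] at hx
    have hTT : T * ENNReal.ofReal t⁻¹ = 1 := by
      rw [hT, ← ENNReal.ofReal_mul ht.le, mul_inv_cancel₀ ht.ne', ENNReal.ofReal_one]
    calc T * ‖covariantGradient A U (lineGradient U) x‖ₑ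
        ≤ T * (d * (a * (ENNReal.ofReal t⁻¹ * P x + b * T * Q x))) := by gcongr
      _ = d * a * (T * ENNReal.ofReal t⁻¹ * P x + T * (b * T * Q x)) := by ring
      _ ≤ d * a * (P x + 1 * (b * T * Q x)) := by
          rw [hTT, one_mul]
          gcongr
          rw [hT]
          simpa using ht1
      _ = _ := by rw [one_mul]
  set a₁ : L0 d := AEEqFun.mk U hUc.aestronglyMeasurable with ha₁
  have hUa : ⇑a₁ =ᵐ[volume] U := AEEqFun.coeFn_mk _ _
  have hX : lpNorm p (u - a₁) ^ p ≤ a ^ p * ∫⁻ x, P x ^ p := by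
    rw [lpNorm_rpow hp, ← lintegral_const_mul' _ _ hap]
    refine lintegral_mono_ae ?_
    filter_upwards [AEEqFun.coeFn_sub u a₁, hUa] with x h1 h2
    rw [h1, Pi.sub_apply, h2, enorm_sub_rev, ← ENNReal.mul_rpow_of_nonneg _ _ hp0.le]
    exact ENNReal.rpow_le_rpow (b1 x) hp0.le
  have hY : (T * sobolevNorm A p a₁) ^ p ≤ T ^ p * (a ^ p * ∫⁻ x, Q x ^ p)
      + (d * a) ^ p * (2 ^ (p - 1) * (∫⁻ x, P x ^ p) + 2 ^ (p - 1) * (b ^ p * T ^ p *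
        ∫⁻ x, Q x ^ p)) := by
    have hS : sobolevNorm A p a₁ ≤
        (∫⁻ x, (‖a₁ x‖ₑ ^ p + ‖covariantGradient A a₁ (lineGradient U) x‖ₑ ^ p)) ^ (1 / p) :=
      iInf₂_le (lineGradient U) ((hasWeakGradient_lineGradient hUl).congr_ae hUa.symm)
    have hS' : sobolevNorm A p a₁ ^ p ≤
        ∫⁻ x, (‖U x‖ₑ ^ p + ‖covariantGradient A U (lineGradient U) x‖ₑ ^ p) := by
      refine (ENNReal.rpow_le_rpow hS hp0.le).trans_eq ?_
      rw [← ENNReal.rpow_mul, one_div_mul_cancel hp0.ne', ENNReal.rpow_one]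
      refine lintegral_congr_ae ?_
      filter_upwards [hUa] with x hx
      simp only [covariantGradient, hx]
    rw [ENNReal.mul_rpow_of_nonneg _ _ hp0.le]
    calc T ^ p * sobolevNorm A p a₁ ^ p
        ≤ T ^ p * ∫⁻ x, (‖U x‖ₑ ^ p + ‖covariantGradient A U (lineGradient U) x‖ₑ ^ p) := by
          gcongr
      _ = ∫⁻ x, (T ^ p * ‖U x‖ₑ ^ p
            + (T * ‖covariantGradient A U (lineGradient U) x‖ₑ) ^ p) := by
          rw [← lintegral_const_mul' _ _ hTp]
          refine lintegral_congr fun x => ?_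
          rw [mul_add, ENNReal.mul_rpow_of_nonneg _ _ hp0.le]
      _ ≤ ∫⁻ x, (T ^ p * (a ^ p * Q x ^ p) + (d * a) ^ p *
            (2 ^ (p - 1) * P x ^ p + 2 ^ (p - 1) * (b ^ p * T ^ p * Q x ^ p))) := by
          refine lintegral_mono_ae ?_
          filter_upwards [b3] with x hx
          refine add_le_add ?_ ?_
          · rw [← ENNReal.mul_rpow_of_nonneg a _ hp0.le]
            gcongr T ^ p * ?_
            exact ENNReal.rpow_le_rpow (b2 x) hp0.le
          · refine (ENNReal.rpow_le_rpow hx hp0.le).trans ?_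
            rw [ENNReal.mul_rpow_of_nonneg _ _ hp0.le]
            gcongr
            refine (ENNReal.rpow_add_le_mul_rpow_add_rpow _ _ hp).trans_eq ?_
            rw [mul_add, ENNReal.mul_rpow_of_nonneg _ _ hp0.le,
              ENNReal.mul_rpow_of_nonneg _ _ hp0.le]
      _ = _ := by
          rw [lintegral_add_left (by fun_prop), lintegral_const_mul' _ _ hTp,
            lintegral_const_mul' _ _ hap, lintegral_const_mul' _ _ hda,
            lintegral_add_left (by fun_prop), lintegral_const_mul' _ _ h2,
            lintegral_const_mul' _ _ h2,
            lintegral_const_mul' _ _ (ENNReal.mul_ne_top hbp hTp)]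
  calc peetreK (lpNorm p) (sobolevNorm A p) t u ^ p
      ≤ (lpNorm p (u - a₁) + T * sobolevNorm A p a₁) ^ p := by
        refine ENNReal.rpow_le_rpow ?_ hp0.le
        exact iInf_le_of_le (u - a₁) (iInf_le_of_le a₁ (iInf_le_of_le (sub_add_cancel u a₁) le_rfl))
    _ ≤ 2 ^ (p - 1) * (lpNorm p (u - a₁) ^ p + (T * sobolevNorm A p a₁) ^ p) :=
        ENNReal.rpow_add_le_mul_rpow_add_rpow _ _ hp
    _ ≤ 2 ^ (p - 1) * (a ^ p * (m ^ (p - 1) * averagedIncrement A p u t)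
          + (T ^ p * (a ^ p * (m ^ p * lpNorm p u ^ p))
            + (d * a) ^ p * (2 ^ (p - 1) * (m ^ (p - 1) * averagedIncrement A p u t)
              + 2 ^ (p - 1) * (b ^ p * T ^ p * (m ^ p * lpNorm p u ^ p))))) := by
        gcongr
        · exact hX.trans (by gcongr)
        · exact hY.trans (by gcongr)
    _ = _ := by
        rw [hC₁, hC₂]
        ring

/-! ### Control of the interpolation norm by the fractional norm -/

/-- Integrating the ball kernels over all scales produces the Gagliardo kernel. -/
theorem lintegral_rpow_mul_ballKernel {d : ℕ} {s p : ℝ} (hsp : 0 < s * p) {h : Rd d}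
    (hh : h ≠ 0) :
    ∫⁻ t in Set.Ioi (0 : ℝ), ENNReal.ofReal (t ^ (-(s * p) - 1)) * ballKernel t h
      = ENNReal.ofReal (2 ^ ((d : ℝ) + s * p) / (d + s * p)) * (‖h‖ₑ ^ ((d : ℝ) + s * p))⁻¹ := by
  have hn : 0 < ‖h‖ := norm_pos_iff.2 hh
  have hd0 : (0 : ℝ) ≤ d := Nat.cast_nonneg d
  have hds : 0 < (d : ℝ) + s * p := by linarith
  have hr : -(s * p) - 1 - d < -1 := by linarith
  -- the translation `h` is seen by the kernel at the scales `t > ‖h‖ / 2`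
  have e : ∀ t ∈ Set.Ioi (0 : ℝ), ENNReal.ofReal (t ^ (-(s * p) - 1)) * ballKernel t h
      = (Set.Ioi (‖h‖ / 2)).indicator
        (fun t => ENNReal.ofReal (t ^ (-(s * p) - 1 - (d : ℝ)))) t := by
    intro t ht
    have ht : 0 < t := ht
    by_cases hth : ‖h‖ / 2 < t
    · rw [Set.indicator_of_mem (Set.mem_Ioi.2 hth), ballKernel, Set.indicator_of_mem
        (by rw [mem_ball_zero_iff]; linarith), ← ENNReal.ofReal_mul (by positivity)]
      congr 1
      rw [Real.rpow_sub ht (-(s * p) - 1), Real.rpow_natCast, mul_one_div]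
    · rw [Set.indicator_of_notMem (by simpa using hth), ballKernel, Set.indicator_of_notMem
        (by rw [mem_ball_zero_iff]; linarith), mul_zero]
  rw [setLIntegral_congr_fun measurableSet_Ioi e, setLIntegral_indicator measurableSet_Ioi,
    Set.inter_eq_left.2 (Set.Ioi_subset_Ioi (by positivity)),
    ← ofReal_integral_eq_lintegral_ofReal (integrableOn_Ioi_rpow_of_lt hr (by positivity))
      ((ae_restrict_iff' measurableSet_Ioi).2 (Eventually.of_forall fun t ht => ?_)),
    integral_Ioi_rpow_of_lt hr (by positivity), ← ofReal_norm,
    ENNReal.ofReal_rpow_of_pos hn, ← ENNReal.ofReal_inv_of_pos (by positivity),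
    ← ENNReal.ofReal_mul (by positivity)]
  · congr 1
    rw [show -(s * p) - 1 - (d : ℝ) + 1 = -((d : ℝ) + s * p) by ring, neg_div_neg_eq,
      Real.rpow_neg (by positivity), Real.div_rpow hn.le (by norm_num)]
    field_simp
  · have : 0 < t := lt_trans (by positivity) ht
    simp only [Pi.zero_apply]
    positivity

theorem lintegral_rpow_mul_lintegral_ballKernel {d : ℕ} (hd : 1 ≤ d) {s p : ℝ} (hsp : 0 < s * p)
    {W : Rd d → ℝ≥0∞} (hW : Measurable W) :
    ∫⁻ t in Set.Ioi (0 : ℝ), ENNReal.ofReal (t ^ (-(s * p) - 1)) * ∫⁻ h, ballKernel t h * W h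
      = ENNReal.ofReal (2 ^ ((d : ℝ) + s * p) / (d + s * p)) *
        ∫⁻ h, (‖h‖ₑ ^ ((d : ℝ) + s * p))⁻¹ * W h := by
  have : Nonempty (Fin d) := ⟨⟨0, hd⟩⟩
  have hkm := measurable_ballKernel_uncurry (d := d)
  have hk2 : ∀ h : Rd d, Measurable fun t => ballKernel t h := fun h =>
    Measurable.of_uncurry_right (f := ballKernel) hkm
  calc ∫⁻ t in Set.Ioi (0 : ℝ), ENNReal.ofReal (t ^ (-(s * p) - 1)) * ∫⁻ h, ballKernel t h * W h
      = ∫⁻ t in Set.Ioi (0 : ℝ), ∫⁻ h,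
          ENNReal.ofReal (t ^ (-(s * p) - 1)) * ballKernel t h * W h := by
        refine lintegral_congr fun t => ?_
        rw [← lintegral_const_mul' _ _ ENNReal.ofReal_ne_top]
        simp only [mul_assoc]
    _ = ∫⁻ h, ∫⁻ t in Set.Ioi (0 : ℝ),
          ENNReal.ofReal (t ^ (-(s * p) - 1)) * ballKernel t h * W h := by
        refine lintegral_lintegral_swap (Measurable.aemeasurable ?_)
        simp only [Function.uncurry_def]
        exact ((by fun_prop : Measurable fun q : ℝ × Rd d =>
          ENNReal.ofReal (q.1 ^ (-(s * p) - 1))).mul hkm).mul (hW.comp measurable_snd)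
    _ = ∫⁻ h, (ENNReal.ofReal (2 ^ ((d : ℝ) + s * p) / (d + s * p)) *
          (‖h‖ₑ ^ ((d : ℝ) + s * p))⁻¹) * W h := by
        refine lintegral_congr_ae ?_
        filter_upwards [Measure.ae_ne volume (0 : Rd d)] with h hh
        have := hk2 h
        rw [lintegral_mul_const _ (by fun_prop), lintegral_rpow_mul_ballKernel hsp hh]
    _ = _ := by
        rw [← lintegral_const_mul' _ _ ENNReal.ofReal_ne_top]
        simp only [mul_assoc]

theorem lintegral_averagedIncrement {d : ℕ} (hd : 1 ≤ d) {A : Rd d → Rd d} (hA : Continuous A)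
    {s p : ℝ} (hsp : 0 < s * p) (u : L0 d) :
    ∫⁻ t in Set.Ioi (0 : ℝ), ENNReal.ofReal (t ^ (-(s * p) - 1)) * averagedIncrement A p u t
      = ENNReal.ofReal (2 ^ ((d : ℝ) + s * p) / (d + s * p)) * gagliardoEnergy A s p u := by
  rw [gagliardoEnergy_eq hA]
  exact lintegral_rpow_mul_lintegral_ballKernel hd hsp (Measurable.lintegral_prod_right
    (f := fun h x : Rd d => ‖magneticTranslation A h u x - u x‖ₑ ^ p)
    ((measurable_enorm_magneticTranslation_sub hA u.measurable measurable_fst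
      measurable_snd).pow_const p))

theorem interpolation_integrand_eq {s p t : ℝ} (hp : 0 ≤ p) (ht : 0 < t) (K : ℝ≥0∞) :
    (ENNReal.ofReal (t ^ (-s)) * K) ^ p * ENNReal.ofReal (1 / t)
      = ENNReal.ofReal (t ^ (-(s * p) - 1)) * K ^ p := by
  rw [ENNReal.mul_rpow_of_nonneg _ _ hp, ENNReal.ofReal_rpow_of_pos (by positivity), mul_right_comm,
    ← ENNReal.ofReal_mul (by positivity), Real.rpow_sub ht, Real.rpow_one, ← Real.rpow_mul ht.le,
    mul_one_div, neg_mul]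

theorem peetreK_le_lpNorm {d : ℕ} (A : Rd d → Rd d) {p : ℝ} (hp : 1 ≤ p) (t : ℝ) (u : L0 d) :
    peetreK (lpNorm p) (sobolevNorm A p) t u ≤ lpNorm p u := by
  have hp0 : 0 < p := by linarith
  refine iInf_le_of_le u (iInf_le_of_le 0 (iInf_le_of_le (add_zero u) ?_))
  have h0 : sobolevNorm A p (0 : L0 d) = 0 := by
    have hw : HasWeakGradient (⇑(0 : L0 d)) (fun _ => 0) := by
      refine HasWeakGradient.congr_ae (u := fun _ => 0) ⟨locallyIntegrable_zero,
        locallyIntegrable_zero, fun φ _ j => by simp⟩ AEEqFun.coeFn_zero.symm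
    refine le_antisymm ((iInf₂_le _ hw).trans_eq ?_) bot_le
    have : ∫⁻ x, (‖(0 : L0 d) x‖ₑ ^ p
        + ‖covariantGradient A (⇑(0 : L0 d)) (fun _ => 0) x‖ₑ ^ p) = ∫⁻ _ : Rd d, 0 := by
      refine lintegral_congr_ae ?_
      filter_upwards [AEEqFun.coeFn_zero (α := Rd d) (β := ℂ) (μ := volume)] with x hx
      have : covariantGradient A (⇑(0 : L0 d)) (fun _ => 0) x = 0 := by
        ext j
        simp [covariantGradient, hx]
      rw [this, hx]
      simp [hp0]
    rw [this, lintegral_zero, ENNReal.zero_rpow_of_pos (by positivity)]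
  rw [h0, mul_zero, add_zero]

theorem exists_interpolationNorm_le {d : ℕ} (hd : 1 ≤ d) {A : Rd d → Rd d} (hA : Continuous A)
    (hdA : HasBoundedExtDeriv A) {s p : ℝ} (hs : 0 < s) (hs1 : s < 1) (hp : 1 ≤ p) :
    ∃ C : NNReal, ∀ u : L0 d, interpolationNorm (lpNorm p) (sobolevNorm A p) s p u
      ≤ C * fractionalNorm A s p u := by
  have hp0 : 0 < p := by linarith
  have hsp : 0 < s * p := by positivity
  obtain ⟨B, hB, hAB⟩ := hdA
  set M : ℝ := (eLpNormEssSup B volume).toReal with hM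
  have hBM : ∀ᵐ x, ‖B x‖ ≤ M := by
    have hfin : eLpNormEssSup B volume ≠ ⊤ := by
      have := hB.eLpNorm_ne_top
      rwa [eLpNorm_exponent_top] at this
    filter_upwards [enorm_ae_le_eLpNormEssSup B volume] with x hx
    rw [← toReal_enorm]
    exact ENNReal.toReal_mono hfin hx
  have hM0 : 0 ≤ M := ENNReal.toReal_nonneg
  obtain ⟨C₁, C₂, hK⟩ := exists_peetreK_rpow_le hA hM0 (abs_flux_le hA hM0 hBM hAB) hp
  set c₁ : ℝ≥0∞ := ENNReal.ofReal (2 ^ ((d : ℝ) + s * p) / (d + s * p)) with hc₁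
  set c₂ : ℝ≥0∞ := ∫⁻ t in Set.Ioc (0 : ℝ) 1, ENNReal.ofReal (t ^ (p - s * p - 1)) with hc₂
  set c₃ : ℝ≥0∞ := ∫⁻ t in Set.Ioi (1 : ℝ), ENNReal.ofReal (t ^ (-(s * p) - 1)) with hc₃
  have hc₁t : c₁ ≠ ⊤ := ENNReal.ofReal_ne_top
  have hc₂t : c₂ ≠ ⊤ := by
    have h1 : -1 < p - s * p - 1 := by nlinarith
    have h2 := intervalIntegral.intervalIntegrable_rpow' (a := 0) (b := 1) h1
    rw [intervalIntegrable_iff_integrableOn_Ioc_of_le zero_le_one] at h2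
    exact h2.lintegral_lt_top.ne
  have hc₃t : c₃ ≠ ⊤ := by
    have h1 : -(s * p) - 1 < -1 := by linarith
    exact (integrableOn_Ioi_rpow_of_lt h1 one_pos).lintegral_lt_top.ne
  -- the summand `1` makes `D` nonzero, so that the bound is also true when the norms are infinite
  set D : ℝ≥0∞ := C₁ * c₁ + C₂ * c₂ + c₃ + 1 with hD
  have hDt : D ≠ ⊤ := by finiteness
  refine ⟨(D ^ (1 / p)).toNNReal, fun u => ?_⟩
  rw [ENNReal.coe_toNNReal (ENNReal.rpow_ne_top_of_nonneg (by positivity) hDt), fractionalNorm,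
    interpolationNorm, ← ENNReal.mul_rpow_of_nonneg _ _ (by positivity)]
  gcongr
  rcases eq_or_ne (lpNorm p u) ⊤ with hu | hu
  · rw [hu, ENNReal.top_rpow_of_pos hp0, top_add, ENNReal.mul_top (by simp [hD])]
    exact le_top
  have huloc : LocallyIntegrable u volume := by
    have : MemLp u (ENNReal.ofReal p) volume := ⟨u.aestronglyMeasurable, hu.lt_top⟩
    exact this.locallyIntegrable (by simpa using hp)
  rw [← Set.Ioc_union_Ioi_eq_Ioi (zero_le_one (α := ℝ))]
  refine (lintegral_union_le _ _ _).trans ?_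
  -- for `t ≤ 1` magnetic mollification is used, for `t > 1` the trivial decomposition `u = u + 0`
  have hsmall : ∫⁻ t in Set.Ioc (0 : ℝ) 1, (ENNReal.ofReal (t ^ (-s)) *
      peetreK (lpNorm p) (sobolevNorm A p) t u) ^ p * ENNReal.ofReal (1 / t)
      ≤ C₁ * (c₁ * gagliardoEnergy A s p u) + C₂ * c₂ * lpNorm p u ^ p := by
    calc _ ≤ ∫⁻ t in Set.Ioc (0 : ℝ) 1,
          (C₁ * (ENNReal.ofReal (t ^ (-(s * p) - 1)) * averagedIncrement A p u t)
          + C₂ * lpNorm p u ^ p * ENNReal.ofReal (t ^ (p - s * p - 1))) := by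
          refine setLIntegral_mono' measurableSet_Ioc fun t ht => ?_
          have ht0 : 0 < t := ht.1
          rw [interpolation_integrand_eq hp0.le ht0]
          have e : ENNReal.ofReal (t ^ (p - s * p - 1))
              = ENNReal.ofReal (t ^ (-(s * p) - 1)) * ENNReal.ofReal t ^ p := by
            rw [ENNReal.ofReal_rpow_of_pos ht0, ← ENNReal.ofReal_mul (by positivity),
              ← Real.rpow_add ht0]
            congr 2
            ring
          calc _ ≤ ENNReal.ofReal (t ^ (-(s * p) - 1)) * (C₁ * averagedIncrement A p u t
                + C₂ * (ENNReal.ofReal t ^ p * lpNorm p u ^ p)) := by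
                gcongr
                exact hK t ht0 ht.2 u huloc
            _ = _ := by rw [e]; ring
      _ = (∫⁻ t in Set.Ioc (0 : ℝ) 1,
            C₁ * (ENNReal.ofReal (t ^ (-(s * p) - 1)) * averagedIncrement A p u t))
          + C₂ * lpNorm p u ^ p * c₂ := by
          rw [lintegral_add_right _ (by fun_prop), lintegral_const_mul (C₂ * lpNorm p u ^ p) (by fun_prop)]
      _ ≤ _ := by
          rw [lintegral_const_mul' _ _ ENNReal.coe_ne_top, mul_right_comm]
          gcongr
          rw [hc₁, ← lintegral_averagedIncrement hd hA hsp]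
          exact lintegral_mono_set Set.Ioc_subset_Ioi_self
  have hlarge : ∫⁻ t in Set.Ioi (1 : ℝ), (ENNReal.ofReal (t ^ (-s)) *
      peetreK (lpNorm p) (sobolevNorm A p) t u) ^ p * ENNReal.ofReal (1 / t)
      ≤ c₃ * lpNorm p u ^ p := by
    rw [hc₃, ← lintegral_mul_const _ (by fun_prop)]
    refine setLIntegral_mono' measurableSet_Ioi fun t ht => ?_
    rw [interpolation_integrand_eq hp0.le (zero_lt_one.trans ht)]
    gcongr
    exact peetreK_le_lpNorm A hp t u
  refine (add_le_add hsmall hlarge).trans ?_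
  set X := lpNorm p u ^ p
  set Y := gagliardoEnergy A s p u
  calc C₁ * (c₁ * Y) + C₂ * c₂ * X + c₃ * X
      ≤ (C₁ * (c₁ * Y) + C₂ * c₂ * X + c₃ * X) + (C₁ * c₁ * X + C₂ * c₂ * Y + c₃ * Y + (X + Y)) :=
        le_self_add
    _ = D * (X + Y) := by rw [hD]; ring

end MagneticSobolev

end

theorem mainTheorem5 (d : ℕ) (hd : 1 ≤ d) (s p : ℝ) (hs0 : 0 < s) (hs1 : s < 1) (hp : 1 ≤ p)
    (A : MagneticSobolev.Rd d → MagneticSobolev.Rd d) (hA : Continuous A)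
    (hdA : MagneticSobolev.HasBoundedExtDeriv A) :
    MagneticSobolev.fractionalSpace A s p =
        MagneticSobolev.interpolationSpace
          (MagneticSobolev.lpNorm p) (MagneticSobolev.sobolevNorm A p) s p ∧
      ∃ C : NNReal, ∀ u ∈ MagneticSobolev.fractionalSpace A s p,
        MagneticSobolev.interpolationNorm
            (MagneticSobolev.lpNorm p) (MagneticSobolev.sobolevNorm A p) s p u
          ≤ (C : ENNReal) * MagneticSobolev.fractionalNorm A s p u ∧
        MagneticSobolev.fractionalNorm A s p u
          ≤ (C : ENNReal) * MagneticSobolev.interpolationNorm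
            (MagneticSobolev.lpNorm p) (MagneticSobolev.sobolevNorm A p) s p u := by
  obtain ⟨C₁, h₁⟩ := MagneticSobolev.exists_interpolationNorm_le hd hA hdA hs0 hs1 hp
  obtain ⟨C₂, h₂⟩ := MagneticSobolev.exists_fractionalNorm_le hd hA hs0.le hp
  refine ⟨Set.ext fun u => ⟨fun hu => (h₁ u).trans_lt (ENNReal.mul_lt_top ENNReal.coe_lt_top hu),
    fun hu => (h₂ u).trans_lt (ENNReal.mul_lt_top ENNReal.coe_lt_top hu)⟩,
    max C₁ C₂, fun u _ => ⟨(h₁ u).trans ?_, (h₂ u).trans ?_⟩⟩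
  · gcongr
    exact le_max_left _ _
  · gcongr
    exact le_max_right _ _
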